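/- Let $\mathbb{N}^*=\{1,2,3,\dots\}$ and let $L^2(0,T)$ denote the space of square-integrable functions on $(0,T)$ with values in $\mathbb{K}=\mathbb{R}$ or $\mathbb{C}$. For any $\gamma_\infty>0$, $\gamma>0$, $N\in\mathbb{N}$, any $S>\pi/\gamma_\infty$ and any $\varepsilon>0$, there is a constant $C=C(\gamma_\infty,\gamma,N,S,\varepsilon)>0$ such that for every real sequence $(\beta_n)_{n\in\mathbb{N}^*}$ satisfying 1. $\beta_{n+1}-\beta_n\ge\gamma$ for all $n\in\mathbb{N}^*$, and $\beta_1\ge\gamma$, 2. $\beta_{n+1}-\beta_n\ge\gamma_\infty$ for all $n\in\mathbb{N}^*$ with $n\ge N$, and for every $0<T\le 1$, there exists a sequence $(u_n)_{n\in\mathbb{N}^*}$ of elements of $L^2(0,T)$ such that 1. $\int_0^T u_n(t)\,e^{-\beta_l^2 t}\,dt=\delta_{n,l}$ for all $l,n\in\mathbb{N}^*$; 2. for every sequence $(a_n)_{n\in\mathbb{N}^*}$ in $\mathbb{K}$ with $\left(\beta_n^2e^{\beta_n^2T}a_n\right)_{n}\in\ell^2(\mathbb{N}^*)$, the series $z=\sum_{n\in\mathbb{N}^*}a_nu_n$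 converges (unconditionally) in $L^2(0,T)$, the series $\sum_{n}\beta_n^2e^{2\beta_n^2T}|a_n|^2$ converges, and $$\|z\|_{L^2(0,T)}^2\le\frac{C}{T^3}\,e^{\frac{(16+\varepsilon)S^2}{T}}\sum_{n\in\mathbb{N}^*}\beta_n^2e^{2\beta_n^2T}|a_n|^2 .$$ -/

import Mathlib

open MeasureTheory Set

/-! ### Ingham's inequality -/

/-! The exponentials `exp (-β l ^ 2 t)` are reached from the sines `sin (β l x)` on `(-S, S)`, where
the frequency gap does the work.

Since `S > π/γ∞`, Ingham's inequality, with Haraux's device for discarding the finitely many badly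
spaced frequencies, bounds each coefficient of a finite sine sum by its L² norm, uniformly in `β`
and `n` (`exists_sine_coeff_bound`). Projecting in L² then gives `v` biorthogonal to the sines with
controlled norm. Its moments `m j` against `x^(2j+1)/(2j+1)!` satisfy `∑ (-1)^j m j (β l)^(2j+1) =
δ` and are at most of size `C S^(2j+1)/(2j+1)!`.

To pass to `(0, T)`, let `r t = exp (-α (1/t + 1/(T-t)))`, flat at both ends, with Laplace transform
`c`. Integrating by parts, `r^(j)` has Laplace transform `b^j c b`, so `U = ∑ (-1)^j m j r^(j)`
satisfies `∫ U exp (-β l ^ 2 t) = c (β l ^ 2) δ / β l`. Cauchy's estimates bound `r^(j)` by `j!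
(2/μ)^j exp (-2α/(3μ))`, with `μ` the distance to the endpoints. The choice `α = 3S²/4` makes the
series for `U` bounded uniformly in `t` (`exists_function_of_moments`).

Normalising by `β n / c (β n ^ 2)` costs `exp (4S²/T + 3 β n ^ 2 T/4)` (`exists_biorthogonal_exp`).
As `3/4 < 1`, the weight `exp (β n ^ 2 T)` absorbs the growth in `n`, and a weighted Cauchy–Schwarz
inequality sums the series. The resulting exponent is `8S²/T`, within the `(16+ε)S²/T` allowed. -/

theorem sum_one_div_four_sq_sub_one_le {ι : Type*} (D : Finset ι) (n : ι → ℕ)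
    (hinj : Set.InjOn n D) (hn : ∀ i ∈ D, 1 ≤ n i) :
    ∑ i ∈ D, 1 / (4 * (n i : ℝ) ^ 2 - 1) ≤ 1 / 2 := by
  classical
  have telescope : ∀ M : ℕ, ∑ r ∈ Finset.range M, 1 / (4 * ((r + 1 : ℕ) : ℝ) ^ 2 - 1)
      = 1 / 2 * (1 - 1 / (2 * (M : ℝ) + 1)) := by
    intro M
    induction M with
    | zero => simp
    | succ M ih =>
      rw [Finset.sum_range_succ, ih]
      have h1 : (0 : ℝ) < 2 * M + 1 := by positivity
      have h2 : (0 : ℝ) < 2 * M + 3 := by positivity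
      have h3 : (4 * ((M + 1 : ℕ) : ℝ) ^ 2 - 1) = (2 * M + 1) * (2 * M + 3) := by
        push_cast; ring
      have h4 : (2 * ((M + 1 : ℕ) : ℝ) + 1) = 2 * M + 3 := by push_cast; ring
      rw [h3, h4]
      field_simp
      ring
  have hpos : ∀ r : ℕ, 0 ≤ 1 / (4 * ((r + 1 : ℕ) : ℝ) ^ 2 - 1) := by
    intro r
    apply one_div_nonneg.mpr
    push_cast
    nlinarith [(Nat.cast_nonneg r : (0 : ℝ) ≤ r)]
  have hinj' : Set.InjOn (fun i => n i - 1) D := by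
    intro a ha b hb hab
    apply hinj ha hb
    have := hn a ha
    have := hn b hb
    simp only at hab
    omega
  have h1 : ∑ i ∈ D, 1 / (4 * (n i : ℝ) ^ 2 - 1)
      = ∑ r ∈ D.image (fun i => n i - 1), 1 / (4 * ((r + 1 : ℕ) : ℝ) ^ 2 - 1) := by
    rw [Finset.sum_image hinj']
    refine Finset.sum_congr rfl fun i hi => ?_
    rw [Nat.sub_add_cancel (hn i hi)]
  obtain ⟨M, hM⟩ := Finset.exists_nat_subset_range (D.image (fun i => n i - 1))
  rw [h1]
  refine (Finset.sum_le_sum_of_subset_of_nonneg hM fun r _ _ => hpos r).trans ?_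
  rw [telescope]
  have : (0 : ℝ) ≤ 1 / (2 * M + 1) := by positivity
  linarith

/-- Half of the off-diagonal sum in Ingham's inequality. -/
theorem sum_ingham_kernel_le_of_pos {ι : Type*} (D : Finset ι) (x : ι → ℝ) {g R : ℝ}
    (hg : 0 < g) (hR : 0 < R) (hgR : Real.pi < g * R)
    (hsep : ∀ i ∈ D, ∀ j ∈ D, i ≠ j → g ≤ |x i - x j|) (hx : ∀ i ∈ D, g ≤ x i) :
    ∑ i ∈ D, 4 * Real.pi * R / (4 * R ^ 2 * x i ^ 2 - Real.pi ^ 2)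
      ≤ 2 * Real.pi * R / (g * R) ^ 2 := by
  have hpi := Real.pi_pos
  -- By separation, the points lie in distinct cells `[k g, (k+1) g)` with `k ≥ 1`. Moving each to
  -- the left end of its cell only increases the kernel, and `π < g R` then reduces the sum to the
  -- telescoping one.
  set n : ι → ℕ := fun i => ⌊x i / g⌋₊ with hn
  have hn1 : ∀ i ∈ D, 1 ≤ n i := by
    intro i hi
    apply Nat.le_floor
    rw [Nat.cast_one, le_div_iff₀ hg]
    linarith [hx i hi]
  have hxn : ∀ i ∈ D, (n i : ℝ) * g ≤ x i := by
    intro i hi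
    rw [← le_div_iff₀ hg]
    exact Nat.floor_le (div_nonneg (hg.le.trans (hx i hi)) hg.le)
  have hxn' : ∀ i, x i < (n i + 1) * g := by
    intro i
    rw [← div_lt_iff₀ hg]
    exact Nat.lt_floor_add_one _
  have hinj : Set.InjOn n D := by
    intro i hi j hj hij
    by_contra hne
    have h := hsep i hi j hj hne
    have h1 := hxn i hi
    have h2 := hxn j hj
    have h3 := hxn' i
    have h4 := hxn' j
    rw [hij] at h1 h3
    have : |x i - x j| < g := by
      rw [abs_lt]; constructor <;> linarith
    linarith
  have hterm : ∀ i ∈ D, 4 * Real.pi * R / (4 * R ^ 2 * x i ^ 2 - Real.pi ^ 2)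
      ≤ 4 * Real.pi * R / (g * R) ^ 2 * (1 / (4 * (n i : ℝ) ^ 2 - 1)) := by
    intro i hi
    have h1 : (1 : ℝ) ≤ n i := by exact_mod_cast hn1 i hi
    have h2 := hxn i hi
    have hgR0 : 0 < g * R := by positivity
    have h3 : (g * R) ^ 2 * (4 * (n i : ℝ) ^ 2 - 1) ≤ 4 * R ^ 2 * x i ^ 2 - Real.pi ^ 2 := by
      have h4 : ((n i : ℝ) * g) ^ 2 ≤ x i ^ 2 := by gcongr
      have h5 : Real.pi ^ 2 ≤ (g * R) ^ 2 := by gcongr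
      have h6 := mul_le_mul_of_nonneg_left h4 (by positivity : 0 ≤ 4 * R ^ 2)
      nlinarith
    have h4 : 0 < 4 * (n i : ℝ) ^ 2 - 1 := by nlinarith
    rw [div_mul_div_comm, mul_one]
    gcongr
  calc _ ≤ ∑ i ∈ D, 4 * Real.pi * R / (g * R) ^ 2 * (1 / (4 * (n i : ℝ) ^ 2 - 1)) :=
        Finset.sum_le_sum hterm
    _ ≤ 4 * Real.pi * R / (g * R) ^ 2 * (1 / 2) := by
        rw [← Finset.mul_sum]
        have := sum_one_div_four_sq_sub_one_le D n hinj hn1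
        gcongr
    _ = _ := by ring

theorem sum_ingham_kernel_le {ι : Type*} [DecidableEq ι] (s : Finset ι) (w : ι → ℝ) {g R : ℝ}
    (hg : 0 < g) (hR : 0 < R) (hgR : Real.pi < g * R)
    (hsep : ∀ i ∈ s, ∀ j ∈ s, i ≠ j → g ≤ |w i - w j|) (j : ι) (hj : j ∈ s) :
    ∑ i ∈ s.erase j, 4 * Real.pi * R / (4 * R ^ 2 * (w i - w j) ^ 2 - Real.pi ^ 2)
      ≤ 4 * Real.pi * R / (g * R) ^ 2 := by
  rw [← Finset.sum_filter_add_sum_filter_not (s.erase j) (fun i => w j < w i)]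
  have h1 := sum_ingham_kernel_le_of_pos ((s.erase j).filter (fun i => w j < w i))
    (fun i => w i - w j) hg hR hgR
    (by
      intro a ha b hb hab
      simp only [Finset.mem_filter, Finset.mem_erase] at ha hb
      have := hsep a ha.1.2 b hb.1.2 hab
      rwa [sub_sub_sub_cancel_right])
    (by
      intro a ha
      simp only [Finset.mem_filter, Finset.mem_erase] at ha
      have := hsep a ha.1.2 j hj ha.1.1
      rwa [abs_of_pos (by linarith)] at this)
  have h2 := sum_ingham_kernel_le_of_pos ((s.erase j).filter (fun i => ¬ w j < w i))
    (fun i => w j - w i) hg hR hgR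
    (by
      intro a ha b hb hab
      simp only [Finset.mem_filter, Finset.mem_erase] at ha hb
      have := hsep a ha.1.2 b hb.1.2 hab
      rwa [sub_sub_sub_cancel_left, abs_sub_comm])
    (by
      intro a ha
      simp only [Finset.mem_filter, Finset.mem_erase] at ha
      have := hsep a ha.1.2 j hj ha.1.1
      rwa [abs_of_nonpos (by linarith), neg_sub] at this)
  have h3 : ∀ i, (w i - w j) ^ 2 = (w j - w i) ^ 2 := fun i => by ring
  have h4 : 4 * Real.pi * R / (g * R) ^ 2
    = 2 * Real.pi * R / (g * R) ^ 2 + 2 * Real.pi * R / (g * R) ^ 2 := by ring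
  rw [h4]
  refine add_le_add h1 ?_
  simp_rw [h3]
  exact h2

/-- Fourier transform of `cos (π t / (2R))` on `[-R, R]`. -/
theorem integral_cos_mul_cexp {R x : ℝ} (hR : 0 < R)
    (hx : 4 * R ^ 2 * x ^ 2 ≠ Real.pi ^ 2) :
    ∫ t in (-R)..R, (Real.cos (Real.pi * t / (2 * R)) : ℂ) * Complex.exp (Complex.I * x * t)
      = ((4 * Real.pi * R * Real.cos (R * x) / (Real.pi ^ 2 - 4 * R ^ 2 * x ^ 2) : ℝ) : ℂ) := by
  set p : ℝ := Real.pi / (2 * R) with hp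
  have hpR : p * R = Real.pi / 2 := by rw [hp]; field_simp
  have hprod : (x + p) * (x - p) ≠ 0 := by
    intro h
    apply hx
    have h1 : x ^ 2 = p ^ 2 := by linarith
    rw [h1]
    have : 2 * (p * R) = Real.pi := by rw [hpR]; ring
    rw [← this]; ring
  have h1 : (x + p) ≠ 0 := left_ne_zero_of_mul hprod
  have h2 : (x - p) ≠ 0 := right_ne_zero_of_mul hprod
  have hI1 : Complex.I * ((x + p : ℝ) : ℂ) ≠ 0 :=
    mul_ne_zero Complex.I_ne_zero (by exact_mod_cast h1)
  have hI2 : Complex.I * ((x - p : ℝ) : ℂ) ≠ 0 :=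
    mul_ne_zero Complex.I_ne_zero (by exact_mod_cast h2)
  have hfun : ∀ t : ℝ,
      (Real.cos (Real.pi * t / (2 * R)) : ℂ) * Complex.exp (Complex.I * x * t)
      = (1 / 2) * (Complex.exp (Complex.I * ((x + p : ℝ) : ℂ) * t)
        + Complex.exp (Complex.I * ((x - p : ℝ) : ℂ) * t)) := by
    intro t
    have : Real.pi * t / (2 * R) = p * t := by rw [hp]; ring
    rw [this, Complex.ofReal_cos, Complex.cos]
    rw [div_mul_eq_mul_div, add_mul, ← Complex.exp_add, ← Complex.exp_add]
    push_cast
    ring_nf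
  have hs : ∀ y : ℝ, Complex.exp (Complex.I * y * R) - Complex.exp (Complex.I * y * ((-R : ℝ) : ℂ))
      = 2 * Complex.I * (Real.sin (y * R) : ℂ) := by
    intro y
    rw [Complex.ofReal_sin, Complex.sin]
    push_cast
    have : Complex.I * (y : ℂ) * -R = -(y * R) * Complex.I := by ring
    rw [this]
    have : Complex.I * (y : ℂ) * R = (y * R) * Complex.I := by ring
    rw [this]
    ring_nf
    rw [Complex.I_sq]; ring
  have hc1 : Real.sin ((x + p) * R) = Real.cos (R * x) := by
    rw [add_mul, hpR, Real.sin_add_pi_div_two, mul_comm]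
  have hc2 : Real.sin ((x - p) * R) = - Real.cos (R * x) := by
    rw [sub_mul, hpR, Real.sin_sub_pi_div_two, mul_comm]
  simp_rw [hfun]
  rw [intervalIntegral.integral_const_mul, intervalIntegral.integral_add
    (Continuous.intervalIntegrable (by fun_prop) _ _)
    (Continuous.intervalIntegrable (by fun_prop) _ _),
    integral_exp_mul_complex hI1, integral_exp_mul_complex hI2, hs, hs, hc1, hc2]
  have e1 : ∀ y c : ℝ, 2 * Complex.I * (c : ℂ) / (Complex.I * (y : ℂ)) = ((2 * c / y : ℝ) : ℂ) := by
    intro y c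
    push_cast
    rw [mul_comm 2 Complex.I, mul_assoc, mul_div_mul_left _ _ Complex.I_ne_zero]
  rw [e1, e1]
  have e2 : (1 / 2 : ℂ) = ((1 / 2 : ℝ) : ℂ) := by push_cast; rfl
  rw [e2, ← Complex.ofReal_add, ← Complex.ofReal_mul]
  congr 1
  have hd : Real.pi ^ 2 - 4 * R ^ 2 * x ^ 2 = - (4 * R ^ 2) * ((x + p) * (x - p)) := by
    have : Real.pi = 2 * (p * R) := by rw [hpR]; ring
    rw [this]; ring
  have hpi : 4 * Real.pi * R = 8 * p * R ^ 2 := by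
    have : Real.pi = 2 * (p * R) := by rw [hpR]; ring
    rw [this]; ring
  rw [hd, hpi]
  field_simp
  ring

/-- Ingham's inequality for finite nonharmonic exponential sums. -/
theorem ingham_inequality {ι : Type*} [DecidableEq ι] (s : Finset ι) (w : ι → ℝ) (c : ι → ℂ)
    {g R : ℝ} (hg : 0 < g) (hR : 0 < R) (hgR : Real.pi < g * R)
    (hsep : ∀ i ∈ s, ∀ j ∈ s, i ≠ j → g ≤ |w i - w j|) :
    (4 * R / Real.pi - 4 * Real.pi * R / (g * R) ^ 2) * ∑ i ∈ s, ‖c i‖ ^ 2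
      ≤ ∫ t in (-R)..R, ‖∑ i ∈ s, c i * Complex.exp (Complex.I * w i * t)‖ ^ 2 := by
  have hpi := Real.pi_pos
  -- The transform of the cosine weight decays like `x⁻²`, so the off-diagonal rows are summable; a
  -- constant weight would give only `x⁻¹`. Since the weight is at most 1, it can be dropped at the
  -- end.
  set K : ℝ → ℂ := fun x => ∫ t in (-R)..R,
    (Real.cos (Real.pi * t / (2 * R)) : ℂ) * Complex.exp (Complex.I * x * t) with hK
  set f : ℝ → ℂ := fun t => ∑ i ∈ s, c i * Complex.exp (Complex.I * w i * t) with hf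
  have hfc : Continuous f := by fun_prop
  have hkc : Continuous fun t : ℝ => Real.cos (Real.pi * t / (2 * R)) := by fun_prop
  have hK0 : K 0 = ((4 * R / Real.pi : ℝ) : ℂ) := by
    have := integral_cos_mul_cexp (x := 0) hR (by
      rw [zero_pow two_ne_zero, mul_zero]; exact (pow_pos hpi 2).ne)
    rw [hK]
    simp only
    rw [this]
    congr 1
    simp
    field_simp
  have hKx : ∀ x : ℝ, g ≤ |x| →
      ‖K x‖ ≤ 4 * Real.pi * R / (4 * R ^ 2 * x ^ 2 - Real.pi ^ 2) := by
    intro x hx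
    have h1 : (g * R) ^ 2 ≤ R ^ 2 * x ^ 2 := by
      rw [← sq_abs x, mul_pow, mul_comm]
      gcongr
    have h2 : Real.pi ^ 2 < (g * R) ^ 2 := by gcongr
    have h3 : 0 < 4 * R ^ 2 * x ^ 2 - Real.pi ^ 2 := by nlinarith
    rw [hK]
    simp only
    rw [integral_cos_mul_cexp hR (by linarith), Complex.norm_real, Real.norm_eq_abs, abs_div,
      abs_sub_comm, abs_of_pos h3, abs_mul, abs_of_pos (by positivity : 0 < 4 * Real.pi * R)]
    refine div_le_div_of_nonneg_right ?_ h3.le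
    exact mul_le_of_le_one_right (by positivity) (Real.abs_cos_le_one _)
  have hquad : ((∫ t in (-R)..R, Real.cos (Real.pi * t / (2 * R)) * ‖f t‖ ^ 2 : ℝ) : ℂ)
      = ∑ i ∈ s, ∑ j ∈ s, c i * (starRingEnd ℂ) (c j) * K (w i - w j) := by
    rw [← intervalIntegral.integral_ofReal]
    have hpt : ∀ t : ℝ, ((Real.cos (Real.pi * t / (2 * R)) * ‖f t‖ ^ 2 : ℝ) : ℂ)
        = ∑ i ∈ s, ∑ j ∈ s, c i * (starRingEnd ℂ) (c j) *
          ((Real.cos (Real.pi * t / (2 * R)) : ℂ)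
            * Complex.exp (Complex.I * ((w i - w j : ℝ) : ℂ) * t)) := by
      intro t
      rw [Complex.ofReal_mul, Complex.ofReal_pow, ← Complex.mul_conj' (f t), hf]
      simp only
      rw [map_sum, Finset.sum_mul_sum, Finset.mul_sum]
      refine Finset.sum_congr rfl fun i _ => ?_
      rw [Finset.mul_sum]
      refine Finset.sum_congr rfl fun j _ => ?_
      have : Complex.exp (Complex.I * ((w i - w j : ℝ) : ℂ) * t)
          = Complex.exp (Complex.I * w i * t)
            * (starRingEnd ℂ) (Complex.exp (Complex.I * w j * t)) := by
        rw [← Complex.exp_conj, ← Complex.exp_add]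
        simp only [map_mul, Complex.conj_I, Complex.conj_ofReal]
        push_cast
        ring_nf
      rw [this, map_mul]
      ring
    simp_rw [hpt]
    rw [intervalIntegral.integral_finsetSum
      (fun i _ => Continuous.intervalIntegrable (by fun_prop) _ _)]
    refine Finset.sum_congr rfl fun i _ => ?_
    rw [intervalIntegral.integral_finsetSum
      (fun i _ => Continuous.intervalIntegrable (by fun_prop) _ _)]
    refine Finset.sum_congr rfl fun j _ => ?_
    rw [intervalIntegral.integral_const_mul]
  have hle : ∫ t in (-R)..R, Real.cos (Real.pi * t / (2 * R)) * ‖f t‖ ^ 2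
      ≤ ∫ t in (-R)..R, ‖f t‖ ^ 2 := by
    apply intervalIntegral.integral_mono (by linarith)
      (Continuous.intervalIntegrable (by fun_prop) _ _)
      (Continuous.intervalIntegrable (by fun_prop) _ _)
    intro t
    exact mul_le_of_le_one_left (by positivity) (Real.cos_le_one _)
  refine le_trans ?_ hle
  set q := 4 * Real.pi * R / (g * R) ^ 2 with hq
  have hre : ∫ t in (-R)..R, Real.cos (Real.pi * t / (2 * R)) * ‖f t‖ ^ 2
      = ∑ i ∈ s, ∑ j ∈ s, (c i * (starRingEnd ℂ) (c j) * K (w i - w j)).re := by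
    have := congrArg Complex.re hquad
    rw [Complex.ofReal_re] at this
    rw [this, Complex.re_sum]
    simp_rw [Complex.re_sum]
  rw [hre]
  set B : ι → ι → ℝ :=
    fun i j => 4 * Real.pi * R / (4 * R ^ 2 * (w i - w j) ^ 2 - Real.pi ^ 2) with hB
  have hBsymm : ∀ i j, B i j = B j i := by
    intro i j
    simp only [hB]
    rw [show (w i - w j) ^ 2 = (w j - w i) ^ 2 by ring]
  -- Schur test: `2 ‖c i‖ ‖c j‖ ≤ ‖c i‖² + ‖c j‖²` splits each cross term in two halves, and
  -- exchanging the summations makes both halves row sums bounded by `q`.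
  have hrow : ∀ i ∈ s, 4 * R / Real.pi * ‖c i‖ ^ 2
      - ∑ j ∈ s.erase i, (‖c i‖ ^ 2 / 2 * B j i + ‖c j‖ ^ 2 / 2 * B i j)
      ≤ ∑ j ∈ s, (c i * (starRingEnd ℂ) (c j) * K (w i - w j)).re := by
    intro i hi
    rw [← Finset.add_sum_erase s _ hi, sub_self, hK0, Complex.mul_conj', ← Complex.ofReal_pow,
      ← Complex.ofReal_mul, Complex.ofReal_re, mul_comm (4 * R / Real.pi), sub_eq_add_neg,
      ← Finset.sum_neg_distrib]
    gcongr with j hj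
    have hj' := Finset.mem_erase.mp hj
    have h1 := hKx (w i - w j) (hsep i hi j hj'.2 hj'.1.symm)
    have h2 : |(c i * (starRingEnd ℂ) (c j) * K (w i - w j)).re| ≤ ‖c i‖ * ‖c j‖ * B i j := by
      refine (Complex.abs_re_le_norm _).trans ?_
      rw [norm_mul, norm_mul, RCLike.norm_conj]
      gcongr
    have h3 : 0 ≤ B i j := (norm_nonneg _).trans h1
    rw [hBsymm j i]
    have h4 : ‖c i‖ * ‖c j‖ * B i j ≤ (‖c i‖ ^ 2 / 2 + ‖c j‖ ^ 2 / 2) * B i j := by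
      gcongr
      nlinarith [sq_nonneg (‖c i‖ - ‖c j‖)]
    have h5 := neg_abs_le (c i * (starRingEnd ℂ) (c j) * K (w i - w j)).re
    linarith
  refine le_trans ?_ (Finset.sum_le_sum hrow)
  have hsum1 : ∀ i ∈ s, ∑ j ∈ s.erase i, B j i ≤ q := fun i hi =>
    sum_ingham_kernel_le s w hg hR hgR hsep i hi
  have hswap : ∑ i ∈ s, ∑ j ∈ s.erase i, ‖c j‖ ^ 2 / 2 * B i j
      = ∑ i ∈ s, ∑ j ∈ s.erase i, ‖c i‖ ^ 2 / 2 * B j i := by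
    apply Finset.sum_comm'
    intro x y
    simp only [Finset.mem_erase]
    tauto
  have hbd : ∑ i ∈ s, ∑ j ∈ s.erase i, ‖c i‖ ^ 2 / 2 * B j i
      ≤ ∑ i ∈ s, ‖c i‖ ^ 2 / 2 * q := by
    refine Finset.sum_le_sum fun i hi => ?_
    rw [← Finset.mul_sum]
    have := hsum1 i hi
    gcongr
  rw [Finset.sum_sub_distrib]
  simp_rw [Finset.sum_add_distrib]
  rw [hswap, ← Finset.mul_sum, sub_mul]
  have : q * ∑ i ∈ s, ‖c i‖ ^ 2 = ∑ i ∈ s, ‖c i‖ ^ 2 / 2 * q + ∑ i ∈ s, ‖c i‖ ^ 2 / 2 * q := by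
    rw [← Finset.sum_add_distrib, Finset.mul_sum]
    exact Finset.sum_congr rfl fun i _ => by ring
  linarith

/-! ### Removing finitely many frequencies -/

/-- A small translation step which separates two frequencies at distance at least `γ`. -/
theorem exists_step_norm_sub_ge {γ d : ℝ} (hγ : 0 < γ) (hd : 0 < d) {a b : ℝ}
    (hab : γ ≤ |a - b|) :
    ∃ δ : ℝ, 0 < δ ∧ δ ≤ d ∧
      min 2 (2 * γ * d / Real.pi) ≤
        ‖Complex.exp (Complex.I * a * δ) - Complex.exp (Complex.I * b * δ)‖ := by
  have hpi := Real.pi_pos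
  have hnorm : ∀ δ : ℝ, ‖Complex.exp (Complex.I * a * δ) - Complex.exp (Complex.I * b * δ)‖
      = 2 * |Real.sin ((a - b) * δ / 2)| := by
    intro δ
    have h1 : Complex.exp (Complex.I * a * δ) - Complex.exp (Complex.I * b * δ)
        = Complex.exp (Complex.I * ((b * δ : ℝ) : ℂ))
          * (Complex.exp (Complex.I * (((a - b) * δ : ℝ) : ℂ)) - 1) := by
      rw [mul_sub, ← Complex.exp_add, mul_one]
      push_cast
      ring_nf
    rw [h1, norm_mul, Complex.norm_exp_I_mul_ofReal, one_mul,
      Complex.norm_exp_I_mul_ofReal_sub_one, norm_mul, Real.norm_eq_abs, Real.norm_eq_abs,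
      abs_of_pos (by norm_num : (0 : ℝ) < 2)]
  have hx : 0 < |a - b| := hγ.trans_le hab
  -- When `|a - b| d ≥ π`, a step of length at most `d` brings the sine to modulus 1. Otherwise the
  -- half-angle for `δ = d` is at most `π/2` and Jordan's inequality applies.
  rcases le_total (Real.pi) (|a - b| * d) with h | h
  · refine ⟨Real.pi / |a - b|, by positivity, ?_, ?_⟩
    · rwa [div_le_iff₀ hx, mul_comm]
    · rw [hnorm]
      have : |Real.sin ((a - b) * (Real.pi / |a - b|) / 2)| = 1 := by
        rcases abs_cases (a - b) with ⟨h1, _⟩ | ⟨h1, _⟩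
        · rw [h1] at hx
          rw [h1, mul_div_cancel₀ _ hx.ne', Real.sin_pi_div_two, abs_one]
        · rw [h1] at hx
          rw [h1, div_neg, mul_neg, mul_div_cancel₀ _ (by linarith : a - b ≠ 0), neg_div,
            Real.sin_neg, Real.sin_pi_div_two, abs_neg, abs_one]
      rw [this, mul_one]
      exact min_le_left _ _
  · refine ⟨d, hd, le_rfl, ?_⟩
    rw [hnorm]
    refine (min_le_right _ _).trans ?_
    have h1 : |(a - b) * d / 2| = |a - b| * d / 2 := by
      rw [abs_div, abs_mul, abs_of_pos hd, abs_of_pos (by norm_num : (0 : ℝ) < 2)]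
    have h2 := Real.mul_abs_le_abs_sin (x := (a - b) * d / 2) (by rw [h1]; linarith)
    rw [h1] at h2
    have h3 : 2 * γ * d / Real.pi ≤ 2 * (2 / Real.pi * (|a - b| * d / 2)) := by
      have : 2 * (2 / Real.pi * (|a - b| * d / 2)) = 2 * |a - b| * d / Real.pi := by ring
      rw [this]
      gcongr
    linarith

/-- Cost of the difference operator that annihilates one frequency: the interval loses a length `d`
at each end, and the squared norm grows by at most `(1 + 1)² = 4`. -/
theorem integral_norm_translate_sub_sq_le {f : ℝ → ℂ} (hf : Continuous f) {R δ d : ℝ}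
    (hδ : 0 < δ) (hδd : δ ≤ d) (hR : d ≤ R) (y : ℝ) :
    ∫ t in (-(R - d))..(R - d), ‖f (t + δ) - Complex.exp (Complex.I * y) * f t‖ ^ 2
      ≤ 4 * ∫ t in (-R)..R, ‖f t‖ ^ 2 := by
  have hc : Continuous fun t => ‖f t‖ ^ 2 := by fun_prop
  have h1 : ∫ t in (-(R - d))..(R - d), ‖f (t + δ)‖ ^ 2 ≤ ∫ t in (-R)..R, ‖f t‖ ^ 2 := by
    rw [intervalIntegral.integral_comp_add_right (fun t => ‖f t‖ ^ 2)]
    refine intervalIntegral.integral_mono_interval (by linarith) (by linarith) (by linarith)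
      (Filter.Eventually.of_forall fun t => by positivity) (hc.intervalIntegrable _ _)
  have h2 : ∫ t in (-(R - d))..(R - d), ‖f t‖ ^ 2 ≤ ∫ t in (-R)..R, ‖f t‖ ^ 2 :=
    intervalIntegral.integral_mono_interval (by linarith) (by linarith) (by linarith)
      (Filter.Eventually.of_forall fun t => by positivity) (hc.intervalIntegrable _ _)
  have h3 : ∫ t in (-(R - d))..(R - d), ‖f (t + δ) - Complex.exp (Complex.I * y) * f t‖ ^ 2
      ≤ ∫ t in (-(R - d))..(R - d), (2 * ‖f (t + δ)‖ ^ 2 + 2 * ‖f t‖ ^ 2) := by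
    apply intervalIntegral.integral_mono (by linarith)
      (Continuous.intervalIntegrable (by fun_prop) _ _)
      (Continuous.intervalIntegrable (by fun_prop) _ _)
    intro t
    have := norm_sub_le (f (t + δ)) (Complex.exp (Complex.I * y) * f t)
    rw [norm_mul, Complex.norm_exp_I_mul_ofReal, one_mul] at this
    have h4 : ‖f (t + δ) - Complex.exp (Complex.I * y) * f t‖ ^ 2
        ≤ (‖f (t + δ)‖ + ‖f t‖) ^ 2 := by gcongr
    simp only
    nlinarith [sq_nonneg (‖f (t + δ)‖ - ‖f t‖)]
  rw [intervalIntegral.integral_add (Continuous.intervalIntegrable (by fun_prop) _ _)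
      (Continuous.intervalIntegrable (by fun_prop) _ _), intervalIntegral.integral_const_mul,
      intervalIntegral.integral_const_mul] at h3
  linarith

/-- Haraux's extension of Ingham's inequality, for one coefficient: finitely many frequencies
`w b`, `b ∈ B`, only need to be separated from `w i₀`. -/
theorem ingham_haraux_coeff {ι : Type*} [DecidableEq ι] (w : ι → ℝ) (s : Finset ι) (i₀ : ι)
    (hi₀ : i₀ ∈ s) {g γ d R₀ : ℝ} (hg : 0 < g) (hγ : 0 < γ) (hd : 0 < d) (hR₀ : 0 < R₀)
    (hgR : Real.pi < g * R₀) (hsep : ∀ i ∈ s, ∀ j ∈ s, i ≠ j → g ≤ |w i - w j|)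
    (B : Finset ι) (hB : ∀ b ∈ B, b ∉ s) (hBγ : ∀ b ∈ B, γ ≤ |w i₀ - w b|) (c : ι → ℂ) {R : ℝ}
    (hR : R₀ + B.card * d ≤ R) :
    (4 * R₀ / Real.pi - 4 * Real.pi * R₀ / (g * R₀) ^ 2)
        * ((min 2 (2 * γ * d / Real.pi)) ^ 2 / 4) ^ B.card * ‖c i₀‖ ^ 2
      ≤ ∫ t in (-R)..R, ‖∑ i ∈ s ∪ B, c i * Complex.exp (Complex.I * w i * t)‖ ^ 2 := by
  have hpi := Real.pi_pos
  have hκ : 0 ≤ 4 * R₀ / Real.pi - 4 * Real.pi * R₀ / (g * R₀) ^ 2 := by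
    rw [sub_nonneg, div_le_div_iff₀ (by positivity) hpi]
    have : Real.pi ^ 2 ≤ (g * R₀) ^ 2 := by gcongr
    nlinarith
  set κ := 4 * R₀ / Real.pi - 4 * Real.pi * R₀ / (g * R₀) ^ 2
  set η := min 2 (2 * γ * d / Real.pi)
  have hη : 0 ≤ η := le_min (by norm_num) (by positivity)
  -- Each `b` is removed by `f(t+δ) - exp(i w_b δ) f(t)`, which multiplies the coefficient `c i` by
  -- `exp(i w_i δ) - exp(i w_b δ)` and shortens the interval; hence `c` and `R` vary. The step `δ`
  -- is adapted to the pair `(i₀, b)`, so only the coefficient at `i₀` stays under control, with a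
  -- loss of `η²/4`.
  induction B using Finset.induction_on generalizing c R with
  | empty =>
    simp only [Finset.card_empty, pow_zero, mul_one, Finset.union_empty, Nat.cast_zero, zero_mul,
      add_zero] at hR ⊢
    have h1 := ingham_inequality s w c hg hR₀ hgR hsep
    have h2 : ∫ t in (-R₀)..R₀, ‖∑ i ∈ s, c i * Complex.exp (Complex.I * w i * t)‖ ^ 2
        ≤ ∫ t in (-R)..R, ‖∑ i ∈ s, c i * Complex.exp (Complex.I * w i * t)‖ ^ 2 :=
      intervalIntegral.integral_mono_interval (by linarith) (by linarith) hR
        (Filter.Eventually.of_forall fun t => by positivity)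
        (Continuous.intervalIntegrable (by fun_prop) _ _)
    refine le_trans ?_ (h1.trans h2)
    gcongr
    exact Finset.single_le_sum (f := fun i => ‖c i‖ ^ 2) (fun i _ => by positivity) hi₀
  | insert b B hb ih =>
    rw [Finset.card_insert_of_notMem hb] at hR ⊢
    push_cast at hR
    obtain ⟨δ, hδ, hδd, hstep⟩ :=
      exists_step_norm_sub_ge hγ hd (hBγ b (Finset.mem_insert_self _ _))
    set c' : ι → ℂ := fun i =>
      c i * (Complex.exp (Complex.I * w i * δ) - Complex.exp (Complex.I * w b * δ)) with hc'
    have h1 := ih (fun x hx => hB x (Finset.mem_insert_of_mem hx))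
      (fun x hx => hBγ x (Finset.mem_insert_of_mem hx)) c' (R := R - d) (by linarith)
    set f : ℝ → ℂ := fun t =>
      ∑ i ∈ s ∪ insert b B, c i * Complex.exp (Complex.I * w i * t) with hf
    have hfc : Continuous f := by fun_prop
    have hdR : d ≤ R := by
      have : 0 ≤ (B.card : ℝ) * d := by positivity
      linarith
    have h2 := integral_norm_translate_sub_sq_le hfc hδ hδd hdR (w b * δ)
    have h3 : ∀ t : ℝ, f (t + δ) - Complex.exp (Complex.I * ((w b * δ : ℝ) : ℂ)) * f t
        = ∑ i ∈ s ∪ B, c' i * Complex.exp (Complex.I * w i * t) := by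
      intro t
      have hbn : b ∉ s ∪ B := by
        rw [Finset.mem_union, not_or]
        exact ⟨hB b (Finset.mem_insert_self _ _), hb⟩
      simp only [hf, hc']
      rw [Finset.union_insert, Finset.mul_sum, ← Finset.sum_sub_distrib,
        Finset.sum_insert hbn]
      have hterm : ∀ i : ι, c i * Complex.exp (Complex.I * w i * ((t + δ : ℝ) : ℂ))
          - Complex.exp (Complex.I * ((w b * δ : ℝ) : ℂ))
            * (c i * Complex.exp (Complex.I * w i * t))
          = c i * (Complex.exp (Complex.I * w i * δ) - Complex.exp (Complex.I * w b * δ))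
            * Complex.exp (Complex.I * w i * t) := by
        intro i
        push_cast
        rw [mul_add (Complex.I * (w i : ℂ)), Complex.exp_add, ← mul_assoc Complex.I]
        ring
      simp_rw [hterm]
      rw [sub_self]
      ring
    simp_rw [h3] at h2
    have h4 : η * ‖c i₀‖ ≤ ‖c' i₀‖ := by
      rw [hc']
      simp only
      rw [norm_mul, mul_comm]
      gcongr
    have h5 : (η * ‖c i₀‖) ^ 2 ≤ ‖c' i₀‖ ^ 2 := by gcongr
    have h6 : κ * (η ^ 2 / 4) ^ B.card * (η * ‖c i₀‖) ^ 2
        ≤ κ * (η ^ 2 / 4) ^ B.card * ‖c' i₀‖ ^ 2 := by gcongr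
    rw [pow_succ]
    have h7 : κ * ((η ^ 2 / 4) ^ B.card * (η ^ 2 / 4)) * ‖c i₀‖ ^ 2
        = (κ * (η ^ 2 / 4) ^ B.card * (η * ‖c i₀‖) ^ 2) / 4 := by ring
    rw [h7]
    linarith

/-! ### Gaps of the sequence of frequencies -/

theorem le_sub_of_lt_of_succ_gap {β : ℕ+ → ℝ} {g : ℝ} (hg : 0 ≤ g) {M : ℕ+}
    (h : ∀ n : ℕ+, M ≤ n → g ≤ β (n + 1) - β n) {k l : ℕ+} (hk : M ≤ k) (hkl : k < l) :
    g ≤ β l - β k := by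
  induction l using PNat.recOn with
  | one => exact absurd hkl (not_lt_one)
  | succ l ih =>
    have hkl' : k ≤ l := PNat.lt_add_one_iff.mp hkl
    have h1 := h l (hk.trans hkl')
    rcases hkl'.eq_or_lt with rfl | hlt
    · exact h1
    · have := ih hlt
      linarith

theorem mul_le_of_succ_gap {β : ℕ+ → ℝ} {γ : ℝ} (h : ∀ n : ℕ+, γ ≤ β (n + 1) - β n)
    (h1 : γ ≤ β 1) (n : ℕ+) : γ * (n : ℕ) ≤ β n := by
  induction n using PNat.recOn with
  | one => simpa using h1
  | succ n ih =>
    have := h n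
    rw [PNat.add_coe, PNat.one_coe]
    push_cast
    linarith

/-! ### Lower bound for the coefficients of sine sums -/

/-- A sine sum is an exponential sum with frequencies `±β l`. Those with `l > N'`, together with `β
n` itself, are `g`-separated. At most `2 N'` others remain, each at distance at least `γ` from `β
n`, and `ingham_haraux_coeff` removes them. Their number does not depend on `F`, so neither does the
constant. -/
theorem exists_sine_coeff_bound (g γ : ℝ) (hg : 0 < g) (hγ : 0 < γ) (N : ℕ) (S : ℝ)
    (hS : Real.pi / g < S) :
    ∃ C : ℝ, 0 < C ∧ ∀ β : ℕ+ → ℝ, (∀ n : ℕ+, γ ≤ β (n + 1) - β n) → γ ≤ β 1 →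
      (∀ n : ℕ+, N ≤ (n : ℕ) → g ≤ β (n + 1) - β n) →
      ∀ (n : ℕ+) (F : Finset ℕ+) (a : ℕ+ → ℝ), n ∈ F →
        |a n| ^ 2 ≤ C * ∫ x in (-S)..S, (∑ l ∈ F, a l * Real.sin (β l * x)) ^ 2 := by
  classical
  have hpi := Real.pi_pos
  have hS0 : 0 < S := (by positivity : 0 < Real.pi / g).trans hS
  -- Ingham's inequality needs only a half-length `R₀ > π/g`; the remaining `S - R₀` is shared among
  -- the `M` possible removal steps.
  set R₀ := (Real.pi / g + S) / 2 with hR₀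
  have hR₀1 : Real.pi / g < R₀ := by rw [hR₀]; linarith
  have hR₀2 : R₀ < S := by rw [hR₀]; linarith
  have hR₀0 : 0 < R₀ := (by positivity : 0 < Real.pi / g).trans hR₀1
  have hgR : Real.pi < g * R₀ := by rw [div_lt_iff₀ hg] at hR₀1; linarith
  set N' : ℕ+ := ⟨max N 1, by positivity⟩ with hN'
  set M : ℕ := 2 * (N' : ℕ) with hM
  have hM0 : 0 < (M : ℝ) := by
    have : 0 < M := by rw [hM]; have := N'.pos; omega
    exact_mod_cast this
  set d := (S - R₀) / M with hd
  have hd0 : 0 < d := div_pos (by linarith) hM0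
  set η := (min 2 (2 * γ * d / Real.pi)) ^ 2 / 4 with hη
  have hmin : 0 < min 2 (2 * γ * d / Real.pi) := lt_min (by norm_num) (by positivity)
  have hη0 : 0 < η := by positivity
  have hη1 : η ≤ 1 := by
    have : (min 2 (2 * γ * d / Real.pi)) ^ 2 ≤ 2 ^ 2 := by
      gcongr
      exact min_le_left _ _
    rw [hη]; linarith
  set κ := 4 * R₀ / Real.pi - 4 * Real.pi * R₀ / (g * R₀) ^ 2 with hκ
  have hκ0 : 0 < κ := by
    rw [hκ, sub_pos, div_lt_div_iff₀ (by positivity) hpi]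
    have : Real.pi ^ 2 < (g * R₀) ^ 2 := by gcongr
    nlinarith
  -- The factor 4 comes from `‖c (true, n)‖ = |a n| / 2`. Since `η ≤ 1`, the power `η ^ M` covers
  -- any smaller number of removals.
  refine ⟨4 * (κ * η ^ M)⁻¹, by positivity, ?_⟩
  intro β hβγ hβ1 hβg n F a hn
  have hgapγ : ∀ k l : ℕ+, k < l → γ ≤ β l - β k := fun k l hkl =>
    le_sub_of_lt_of_succ_gap hγ.le (M := 1) (fun n _ => hβγ n) one_le hkl
  have hgapg : ∀ k l : ℕ+, N' ≤ k → k < l → g ≤ β l - β k := fun k l hk hkl =>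
    le_sub_of_lt_of_succ_gap hg.le (M := N')
      (fun n hn => hβg n ((le_max_left N 1).trans (by exact_mod_cast hn))) hk hkl
  have hβpos : ∀ l, γ ≤ β l := by
    intro l
    refine le_trans ?_ (mul_le_of_succ_gap hβγ hβ1 l)
    have : (1 : ℝ) ≤ (l : ℕ) := by exact_mod_cast l.pos
    nlinarith
  have hβlarge : ∀ l, N' < l → g ≤ β l := by
    intro l hl
    have := hgapg N' l le_rfl hl
    have := hβpos N'
    linarith
  set w : Bool × ℕ+ → ℝ := fun p => if p.1 then β p.2 else - β p.2 with hw
  set c : Bool × ℕ+ → ℂ := fun p =>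
    if p.1 then -(Complex.I / 2) * (a p.2 : ℂ) else (Complex.I / 2) * (a p.2 : ℂ) with hc
  set Λ : Finset (Bool × ℕ+) := Finset.univ ×ˢ F with hΛ
  set s := Λ.filter (fun p => N' < p.2 ∨ p = (true, n)) with hs
  set B := Λ.filter (fun p => ¬ (N' < p.2 ∨ p = (true, n))) with hB
  have hunion : s ∪ B = Λ := Finset.filter_union_filter_not_eq _ _
  have hcard : B.card ≤ M := by
    have : B ⊆ Finset.univ ×ˢ Finset.Icc 1 N' := by
      intro p hp
      rw [hB, Finset.mem_filter, not_or, not_lt] at hp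
      simp only [Finset.mem_product, Finset.mem_univ, true_and, Finset.mem_Icc]
      exact ⟨one_le, hp.2.1⟩
    refine (Finset.card_le_card this).trans ?_
    rw [Finset.card_product, hM]
    simp
  have hi₀ : (true, n) ∈ s := by simp [hs, hΛ, hn]
  have hsep0 : ∀ k : ℕ+, ∀ b : Bool, N' < k → (b, k) ≠ (true, n) →
      g ≤ |w (b, k) - w (true, n)| := by
    intro k b hk hne
    cases b with
    | true =>
      have hkn : k ≠ n := fun h => hne (by rw [h])
      simp only [hw, if_true]
      rcases lt_or_gt_of_ne hkn with h | h
      · have := hgapg k n hk.le h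
        rw [abs_sub_comm]
        exact this.trans (le_abs_self _)
      · refine le_trans ?_ (le_abs_self _)
        rcases le_or_gt N' n with h' | h'
        · exact hgapg n k h' h
        · have h2 := hgapg N' k le_rfl hk
          have h3 := hgapγ n N' h'
          linarith
    | false =>
      simp only [hw, if_true, Bool.false_eq_true, if_false]
      rw [abs_sub_comm]
      refine le_trans ?_ (le_abs_self _)
      have := hβlarge k hk
      have := hβpos n
      linarith
  have hsep : ∀ i ∈ s, ∀ j ∈ s, i ≠ j → g ≤ |w i - w j| := by
    rintro ⟨b, k⟩ hi ⟨b', l⟩ hj hij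
    rw [hs, Finset.mem_filter] at hi hj
    rcases hi.2 with hk | hk
    · rcases hj.2 with hl | hl
      · simp only at hk hl
        have hkl : ∀ k l : ℕ+, N' < k → N' < l → k ≠ l → g ≤ |β k - β l| := by
          intro k l hk hl hne
          rcases lt_or_gt_of_ne hne with h | h
          · rw [abs_sub_comm]
            exact (hgapg k l hk.le h).trans (le_abs_self _)
          · exact (hgapg l k hl.le h).trans (le_abs_self _)
        have h1 := hβlarge k hk
        have h2 := hβlarge l hl
        cases b <;> cases b' <;>
          simp only [hw, if_true, Bool.false_eq_true, if_false]
        · have := hkl l k hl hk (fun h => hij (by rw [h]))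
          rwa [neg_sub_neg]
        · rw [abs_sub_comm]
          refine le_trans ?_ (le_abs_self _)
          linarith
        · refine le_trans ?_ (le_abs_self _)
          linarith
        · exact hkl k l hk hl (fun h => hij (by rw [h]))
      · rw [hl] at hij ⊢
        exact hsep0 k b hk hij
    · rw [hk] at hij ⊢
      rcases hj.2 with hl | hl
      · rw [abs_sub_comm]
        exact hsep0 l b' hl hij.symm
      · exact absurd hl.symm hij
  have hBs : ∀ b ∈ B, b ∉ s := by
    intro b hb hbs
    rw [hB, Finset.mem_filter] at hb
    rw [hs, Finset.mem_filter] at hbs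
    exact hb.2 hbs.2
  have hBγ : ∀ b ∈ B, γ ≤ |w (true, n) - w b| := by
    rintro ⟨b, l⟩ hb
    rw [hB, Finset.mem_filter, not_or] at hb
    have hne := hb.2.2
    cases b with
    | true =>
      have hln : l ≠ n := fun h => hne (by rw [h])
      simp only [hw, if_true]
      rcases lt_or_gt_of_ne hln with h | h
      · exact (hgapγ l n h).trans (le_abs_self _)
      · rw [abs_sub_comm]
        exact (hgapγ n l h).trans (le_abs_self _)
    | false =>
      simp only [hw, if_true, Bool.false_eq_true, if_false]
      refine le_trans ?_ (le_abs_self _)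
      have := hβpos l
      have := hβpos n
      linarith
  have hRS : R₀ + B.card * d ≤ S := by
    have h1 : (B.card : ℝ) * d ≤ M * d := by
      gcongr
    have h2 : M * d = S - R₀ := by rw [hd]; field_simp
    linarith
  have key := ingham_haraux_coeff w s (true, n) hi₀ hg hγ hd0 hR₀0 hgR hsep B hBs hBγ c hRS
  rw [hunion] at key
  have hsum : ∀ t : ℝ, ‖∑ i ∈ Λ, c i * Complex.exp (Complex.I * w i * t)‖ ^ 2
      = (∑ l ∈ F, a l * Real.sin (β l * t)) ^ 2 := by
    intro t
    have : ∑ i ∈ Λ, c i * Complex.exp (Complex.I * w i * t)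
        = ((∑ l ∈ F, a l * Real.sin (β l * t) : ℝ) : ℂ) := by
      rw [hΛ, Finset.sum_product_right, Complex.ofReal_sum]
      refine Finset.sum_congr rfl fun l _ => ?_
      rw [Fintype.sum_bool]
      simp only [hc, hw, if_true, Bool.false_eq_true, if_false]
      rw [Complex.ofReal_mul, Complex.ofReal_sin, Complex.sin]
      push_cast
      ring_nf
    rw [this, Complex.norm_real, Real.norm_eq_abs, sq_abs]
  simp_rw [hsum] at key
  have hcn : ‖c (true, n)‖ ^ 2 = |a n| ^ 2 / 4 := by
    simp only [hc, if_true]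
    rw [norm_mul, norm_neg, norm_div, Complex.norm_I, Complex.norm_real, Real.norm_eq_abs,
      mul_pow]
    norm_num
    ring
  rw [hcn] at key
  have hpow : η ^ M ≤ η ^ B.card := pow_le_pow_of_le_one hη0.le hη1 hcard
  have h1 : κ * η ^ M * (|a n| ^ 2 / 4) ≤ κ * η ^ B.card * (|a n| ^ 2 / 4) := by gcongr
  have h2 := h1.trans key
  rw [mul_assoc, ← div_eq_inv_mul, ← mul_div_assoc, le_div_iff₀ (by positivity)]
  linarith

/-! ### Biorthogonal vectors in Hilbert spaces -/

/-- The coefficient bound says that `f n` lies at distance at least `C^(-1/2)` from the closed span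
of the other vectors. The residual of its projection onto that span, divided by its squared norm, is
the required vector. -/
theorem exists_biorthogonal_of_coeff_bound {H ι : Type*} [NormedAddCommGroup H]
    [InnerProductSpace ℝ H] [CompleteSpace H] [DecidableEq ι] (f : ι → H) (n : ι) {C : ℝ}
    (hC : 0 < C)
    (h : ∀ (F : Finset ι) (a : ι → ℝ), n ∈ F → |a n| ^ 2 ≤ C * ‖∑ l ∈ F, a l • f l‖ ^ 2) :
    ∃ v : H, (∀ l, inner ℝ v (f l) = if n = l then 1 else 0) ∧ ‖v‖ ^ 2 ≤ C := by
  set V : Submodule ℝ H := Submodule.span ℝ (f '' {l | l ≠ n}) with hV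
  set K := V.topologicalClosure with hK
  have hspan : ∀ x ∈ V, 1 ≤ C * ‖f n - x‖ ^ 2 := by
    intro x hx
    obtain ⟨b, hb, rfl⟩ := (Finsupp.mem_span_image_iff_linearCombination ℝ).mp hx
    have hbn : n ∉ b.support := fun hmem => (hb hmem) rfl
    have h1 := h (insert n b.support) (fun l => if l = n then 1 else - b l)
      (Finset.mem_insert_self _ _)
    rw [Finset.sum_insert hbn] at h1
    simp only [if_true, abs_one, one_pow, one_smul] at h1
    have h2 : ∑ l ∈ b.support, (if l = n then (1 : ℝ) else - b l) • f l
        = - Finsupp.linearCombination ℝ f b := by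
      rw [Finsupp.linearCombination_apply, Finsupp.sum, ← Finset.sum_neg_distrib]
      refine Finset.sum_congr rfl fun l hl => ?_
      rw [if_neg (fun (h : l = n) => hbn (h ▸ hl)), neg_smul]
    rwa [h2, ← sub_eq_add_neg] at h1
  have hclos : ∀ x ∈ K, 1 ≤ C * ‖f n - x‖ ^ 2 := by
    intro x hx
    have hcl : IsClosed {x : H | 1 ≤ C * ‖f n - x‖ ^ 2} :=
      isClosed_le continuous_const (by fun_prop)
    exact closure_minimal (s := (V : Set H)) hspan hcl hx
  have : CompleteSpace K := (Submodule.isClosed_topologicalClosure V).completeSpace_coe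
  set p := K.starProjection (f n) with hp
  have hpK : p ∈ K := Submodule.starProjection_apply_mem K _
  set v₀ := f n - p with hv₀
  have horth : ∀ x ∈ K, inner ℝ v₀ x = 0 := fun x hx =>
    Submodule.starProjection_inner_eq_zero _ _ hx
  have hv1 : 1 ≤ C * ‖v₀‖ ^ 2 := hclos p hpK
  have hv0 : 0 < ‖v₀‖ ^ 2 := by
    by_contra hneg
    nlinarith [sq_nonneg ‖v₀‖]
  refine ⟨(‖v₀‖ ^ 2)⁻¹ • v₀, ?_, ?_⟩
  · intro l
    rw [real_inner_smul_left]
    split_ifs with hnl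
    · subst hnl
      have : inner ℝ v₀ (f n) = ‖v₀‖ ^ 2 := by
        have h3 : f n = v₀ + p := by rw [hv₀]; abel
        rw [h3, inner_add_right, horth p hpK, add_zero, real_inner_self_eq_norm_sq]
      rw [this, inv_mul_cancel₀ hv0.ne']
    · rw [horth (f l), mul_zero]
      exact Submodule.le_topologicalClosure V
        (Submodule.subset_span ⟨l, fun h => hnl h.symm, rfl⟩)
  · rw [norm_smul, mul_pow, norm_inv, Real.norm_of_nonneg hv0.le, inv_pow, sq (‖v₀‖ ^ 2), mul_inv,
      mul_assoc, inv_mul_cancel₀ hv0.ne', mul_one, inv_le_iff_one_le_mul₀ hv0]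
    exact hv1

/-! ### Biorthogonal moment sequences -/

/-- For each `n` there is an odd power series, dominated by that of `C sinh (S z)`, which takes
the value `1` at `β n` and vanishes at the other `β l`. -/
theorem exists_biorthogonal_moments (g γ : ℝ) (hg : 0 < g) (hγ : 0 < γ) (N : ℕ) (S : ℝ)
    (hS : Real.pi / g < S) :
    ∃ C : ℝ, 0 < C ∧ ∀ β : ℕ+ → ℝ, (∀ n : ℕ+, γ ≤ β (n + 1) - β n) → γ ≤ β 1 →
      (∀ n : ℕ+, N ≤ (n : ℕ) → g ≤ β (n + 1) - β n) →
      ∀ n : ℕ+, ∃ m : ℕ → ℝ,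
        (∀ j, |m j| ≤ C * S ^ (2 * j + 1) / ((2 * j + 1).factorial : ℝ)) ∧
        ∀ l, HasSum (fun j => (-1) ^ j * m j * β l ^ (2 * j + 1)) (if n = l then 1 else 0) := by
  classical
  have hS0 : 0 < S := (by have := Real.pi_pos; positivity : 0 < Real.pi / g).trans hS
  obtain ⟨C, hC, hbound⟩ := exists_sine_coeff_bound g γ hg hγ N S hS
  -- This bounds the L¹ norm of `v`: integrate `|v| ≤ 1/2 + v²/2` over an interval of length `2S`.
  refine ⟨S + C / 2, by positivity, ?_⟩
  intro β hβγ hβ1 hβg n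
  set μ : Measure ℝ := volume.restrict (Ioc (-S) S) with hμ
  have hmem : ∀ l : ℕ+, MemLp (fun x => Real.sin (β l * x)) 2 μ := fun l =>
    MemLp.of_bound (by fun_prop) 1 (Filter.Eventually.of_forall fun x => by
      rw [Real.norm_eq_abs]; exact Real.abs_sin_le_one _)
  set f : ℕ+ → Lp ℝ 2 μ := fun l => (hmem l).toLp _ with hf
  have hfae : ∀ l, f l =ᵐ[μ] fun x => Real.sin (β l * x) := fun l => (hmem l).coeFn_toLp
  have hnormsq : ∀ v : Lp ℝ 2 μ, ‖v‖ ^ 2 = ∫ x, v x ^ 2 ∂μ := by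
    intro v
    rw [← real_inner_self_eq_norm_sq, L2.inner_def]
    refine integral_congr_ae (Filter.Eventually.of_forall fun x => ?_)
    simp [sq]
  have hcoeff : ∀ (F : Finset ℕ+) (a : ℕ+ → ℝ), n ∈ F →
      |a n| ^ 2 ≤ C * ‖∑ l ∈ F, a l • f l‖ ^ 2 := by
    intro F a hn
    refine (hbound β hβγ hβ1 hβg n F a hn).trans (le_of_eq ?_)
    rw [hnormsq, intervalIntegral.integral_of_le (by linarith)]
    congr 1
    apply integral_congr_ae
    have h1 : ∀ G : Finset ℕ+, ⇑(∑ l ∈ G, a l • f l)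
        =ᵐ[μ] fun x => ∑ l ∈ G, a l * Real.sin (β l * x) := by
      intro G
      induction G using Finset.induction_on with
      | empty =>
        simp only [Finset.sum_empty]
        exact Lp.coeFn_zero ℝ 2 μ
      | insert k G hk ih =>
        rw [Finset.sum_insert hk]
        filter_upwards [Lp.coeFn_add (a k • f k) (∑ l ∈ G, a l • f l), ih, hfae k,
          Lp.coeFn_smul (a k) (f k)] with x h1 h2 h3 h4
        rw [h1, Pi.add_apply, h2, h4, Pi.smul_apply, h3, Finset.sum_insert hk, smul_eq_mul]
    filter_upwards [h1 F] with x hx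
    rw [hx]
  obtain ⟨v, hv, hvC⟩ := exists_biorthogonal_of_coeff_bound f n hC hcoeff
  have hvL2 : MemLp v 2 μ := Lp.memLp v
  have hvint : Integrable v μ := hvL2.integrable (by norm_num)
  have hv2int : Integrable (fun x => v x ^ 2) μ := hvL2.integrable_sq
  have hL1 : ∫ x, |v x| ∂μ ≤ S + C / 2 := by
    have h1 : ∫ x, |v x| ∂μ ≤ ∫ x, (1 / 2 + v x ^ 2 / 2) ∂μ := by
      apply integral_mono hvint.abs ((integrable_const _).add (hv2int.div_const 2))
      intro x
      change |v x| ≤ 1 / 2 + v x ^ 2 / 2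
      nlinarith [sq_nonneg (|v x| - 1), sq_abs (v x)]
    have hμS : μ.real univ = 2 * S := by
      rw [hμ, measureReal_restrict_apply_univ, Real.volume_real_Ioc_of_le (by linarith)]
      ring
    have h2 : ∫ x, (1 / 2 + v x ^ 2 / 2) ∂μ = S + ‖v‖ ^ 2 / 2 := by
      rw [integral_add (integrable_const _) (hv2int.div_const 2), integral_div 2 (fun x => v x ^ 2),
        ← hnormsq, integral_const, hμS, smul_eq_mul]
      ring
    linarith
  have hIoc : ∀ᵐ x ∂μ, |x| ≤ S := by
    rw [hμ]
    filter_upwards [ae_restrict_mem measurableSet_Ioc] with x hx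
    exact abs_le.mpr ⟨hx.1.le, hx.2⟩
  have hpow : ∀ j : ℕ, ∀ᵐ x ∂μ, |v x * (x ^ (2 * j + 1) / ((2 * j + 1).factorial : ℝ))|
      ≤ |v x| * (S ^ (2 * j + 1) / ((2 * j + 1).factorial : ℝ)) := by
    intro j
    filter_upwards [hIoc] with x hx
    rw [abs_mul, abs_div, abs_pow, Nat.abs_cast]
    gcongr
  -- With these moments, the required series is `∫ v sin (β l x)` with the sine expanded in its
  -- Taylor series.
  refine ⟨fun j => ∫ x, v x * (x ^ (2 * j + 1) / ((2 * j + 1).factorial : ℝ)) ∂μ, ?_, ?_⟩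
  · intro j
    have h1 : |∫ x, v x * (x ^ (2 * j + 1) / ((2 * j + 1).factorial : ℝ)) ∂μ|
        ≤ ∫ x, |v x| * (S ^ (2 * j + 1) / ((2 * j + 1).factorial : ℝ)) ∂μ :=
      norm_integral_le_of_norm_le (f := fun x =>
        v x * (x ^ (2 * j + 1) / ((2 * j + 1).factorial : ℝ))) (hvint.abs.mul_const _) (hpow j)
    rw [integral_mul_const] at h1
    refine h1.trans ?_
    rw [mul_div_assoc]
    gcongr
  · intro l
    have hinner : ∫ x, v x * Real.sin (β l * x) ∂μ = if n = l then 1 else 0 := by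
      rw [← hv l, L2.inner_def]
      apply integral_congr_ae
      filter_upwards [hfae l] with x hx
      rw [hx]
      simp [mul_comm]
    rw [← hinner]
    have hterm : ∀ j : ℕ,
        (-1) ^ j * (∫ x, v x * (x ^ (2 * j + 1) / ((2 * j + 1).factorial : ℝ)) ∂μ)
          * β l ^ (2 * j + 1)
        = ∫ x, v x * ((-1) ^ j * (β l * x) ^ (2 * j + 1) / ((2 * j + 1).factorial : ℝ)) ∂μ := by
      intro j
      rw [mul_right_comm, ← integral_const_mul]
      congr 1
      ext x
      rw [mul_pow]
      ring
    simp_rw [hterm]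
    have hsinh := Real.hasSum_sinh (|β l| * S)
    refine hasSum_integral_of_dominated_convergence
      (fun j x => |v x| * ((|β l| * S) ^ (2 * j + 1) / ((2 * j + 1).factorial : ℝ)))
      (fun j => hvL2.1.mul (by fun_prop)) ?_ ?_ ?_ ?_
    · intro j
      filter_upwards [hIoc] with x hx
      rw [Real.norm_eq_abs, abs_mul, abs_div, Nat.abs_cast, abs_mul, abs_pow, abs_pow, abs_neg,
        abs_one, one_pow, one_mul, abs_mul]
      gcongr
    · exact Filter.Eventually.of_forall fun x => hsinh.summable.mul_left _
    · simp_rw [tsum_mul_left]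
      exact hvint.abs.mul_const _
    · exact Filter.Eventually.of_forall fun x => (Real.hasSum_sin (β l * x)).mul_left _

/-! ### A flat function and its derivatives -/

/-- Inversion sends this disc to the disc with diameter `[1/(t+r), 1/(t-r)]`, whose leftmost point
is `1/(t+r)`. -/
theorem one_div_add_le_re_inv {z : ℂ} {t r : ℝ} (hr : 0 ≤ r) (hrt : r < t)
    (hz : ‖z - t‖ ≤ r) : 1 / (t + r) ≤ (z⁻¹).re := by
  have h1 : (z.re - t) ^ 2 + z.im ^ 2 ≤ r ^ 2 := by
    have h2 : ‖z - t‖ ^ 2 ≤ r ^ 2 := by gcongr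
    rw [Complex.sq_norm, Complex.normSq_apply] at h2
    simp only [Complex.sub_re, Complex.ofReal_re, Complex.sub_im, Complex.ofReal_im, sub_zero] at h2
    nlinarith
  have hre : |z.re - t| ≤ r := by
    apply abs_le_of_sq_le_sq _ hr
    nlinarith [sq_nonneg z.im]
  have h3 := (abs_le.mp hre).1
  have h4 := (abs_le.mp hre).2
  have hz0 : 0 < z.re := by linarith
  have hn : 0 < Complex.normSq z := by
    rw [Complex.normSq_apply]; nlinarith [sq_nonneg z.im]
  rw [Complex.inv_re, div_le_div_iff₀ (by linarith) hn, Complex.normSq_apply]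
  nlinarith

/-- `exp (-α (1/z + 1/(T-z)))`, flat at both ends of the interval `(0, T)`. -/
noncomputable def flatExp (α T : ℝ) (z : ℂ) : ℂ :=
  Complex.exp (-(α : ℂ) * (z⁻¹ + (T - z)⁻¹))

/-- The pole at the nearer endpoint alone contributes a real part of at least `1/(m + m/2) =
2/(3m)`; the other pole contributes positively and is discarded. -/
theorem norm_flatExp_le {α T t : ℝ} (hα : 0 ≤ α) (ht : t ∈ Ioo 0 T) {z : ℂ}
    (hz : ‖z - t‖ ≤ min t (T - t) / 2) :
    ‖flatExp α T z‖ ≤ Real.exp (-(2 * α / (3 * min t (T - t)))) := by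
  have ht0 : 0 < t := ht.1
  have htT : 0 < T - t := sub_pos.mpr ht.2
  set m := min t (T - t) with hm
  have hm0 : 0 < m := lt_min ht0 htT
  have hmt : m ≤ t := min_le_left _ _
  have hmT : m ≤ T - t := min_le_right _ _
  have h1 : 1 / (t + m / 2) ≤ (z⁻¹).re :=
    one_div_add_le_re_inv (by linarith) (by linarith) hz
  have h2 : 1 / (T - t + m / 2) ≤ (((T : ℂ) - z)⁻¹).re := by
    refine one_div_add_le_re_inv (by linarith) (by linarith) ?_
    have : (T : ℂ) - z - ((T - t : ℝ) : ℂ) = -(z - t) := by push_cast; ring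
    rwa [this, norm_neg]
  have h1' : 0 ≤ 1 / (t + m / 2) := by positivity
  have h2' : 0 ≤ 1 / (T - t + m / 2) := by positivity
  have h3 : 2 / (3 * m) ≤ (z⁻¹ + ((T : ℂ) - z)⁻¹).re := by
    rw [Complex.add_re]
    have hmm : 2 / (3 * m) = 1 / (m + m / 2) := by field_simp; ring
    rw [hmm]
    rcases min_choice t (T - t) with h | h
    · rw [← hm] at h
      rw [← h] at h1 h1'
      linarith
    · rw [← hm] at h
      rw [← h] at h2 h2'
      linarith
  rw [flatExp, Complex.norm_exp, ← Complex.ofReal_neg, Complex.re_ofReal_mul]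
  apply Real.exp_le_exp.mpr
  have h4 := mul_le_mul_of_nonneg_left h3 hα
  have h5 : α * (2 / (3 * m)) = 2 * α / (3 * m) := by ring
  linarith

theorem differentiableOn_flatExp (α T : ℝ) :
    DifferentiableOn ℂ (flatExp α T) {z : ℂ | z ≠ 0 ∧ z ≠ T} := by
  intro z hz
  have h2 : (T : ℂ) - z ≠ 0 := sub_ne_zero.mpr hz.2.symm
  have h1 : z ≠ 0 := hz.1
  unfold flatExp
  apply DifferentiableAt.differentiableWithinAt
  fun_prop (disch := assumption)

theorem isOpen_ne_and_ne (a b : ℂ) : IsOpen {z : ℂ | z ≠ a ∧ z ≠ b} :=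
  isOpen_ne.inter isOpen_ne

/-- Cauchy's estimate on the circle whose radius is half the distance to the nearer endpoint. -/
theorem norm_iteratedDeriv_flatExp_le {α T t : ℝ} (hα : 0 ≤ α) (ht : t ∈ Ioo 0 T) (j : ℕ) :
    ‖iteratedDeriv j (flatExp α T) t‖
      ≤ j.factorial * (2 / min t (T - t)) ^ j * Real.exp (-(2 * α / (3 * min t (T - t)))) := by
  have ht0 : 0 < t := ht.1
  have htT : 0 < T - t := sub_pos.mpr ht.2
  have hm0 : 0 < min t (T - t) := lt_min ht0 htT
  have hsub : Metric.closedBall (t : ℂ) (min t (T - t) / 2) ⊆ {z : ℂ | z ≠ 0 ∧ z ≠ T} := by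
    intro z hz
    rw [Metric.mem_closedBall, dist_eq_norm] at hz
    constructor
    · rintro rfl
      rw [zero_sub, norm_neg, Complex.norm_real, Real.norm_of_nonneg ht0.le] at hz
      linarith [min_le_left t (T - t)]
    · rintro rfl
      rw [← Complex.ofReal_sub, Complex.norm_real, Real.norm_of_nonneg htT.le] at hz
      linarith [min_le_right t (T - t)]
  have hd : DiffContOnCl ℂ (flatExp α T) (Metric.ball (t : ℂ) (min t (T - t) / 2)) :=
    ((differentiableOn_flatExp α T).mono hsub).diffContOnCl_ball subset_rfl
  have h := Complex.norm_iteratedDeriv_le_of_forall_mem_sphere_norm_le j (by positivity) hd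
    (fun z hz => norm_flatExp_le hα ht (by
      rw [← dist_eq_norm]; exact (Metric.mem_sphere.mp hz).le))
  refine h.trans (le_of_eq ?_)
  rw [div_pow, div_pow]
  field_simp

theorem hasDerivAt_iteratedDeriv_flatExp {α T t : ℝ} (ht : t ∈ Ioo 0 T) (j : ℕ) :
    HasDerivAt (iteratedDeriv j (flatExp α T)) (iteratedDeriv (j + 1) (flatExp α T) t) (t : ℂ) := by
  rw [iteratedDeriv_succ]
  apply DifferentiableAt.hasDerivAt
  have hmem : (t : ℂ) ∈ {z : ℂ | z ≠ 0 ∧ z ≠ T} :=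
    ⟨by exact_mod_cast ht.1.ne', by exact_mod_cast ht.2.ne⟩
  have h1 : ∀ j : ℕ, DifferentiableOn ℂ (iteratedDeriv j (flatExp α T)) {z : ℂ | z ≠ 0 ∧ z ≠ T} := by
    intro j
    induction j with
    | zero => rw [iteratedDeriv_zero]; exact differentiableOn_flatExp α T
    | succ j ih => rw [iteratedDeriv_succ]; exact ih.deriv (isOpen_ne_and_ne _ _)
  exact (h1 j).differentiableAt ((isOpen_ne_and_ne _ _).mem_nhds hmem)

/-- The derivatives of `exp (-α (1/t + 1/(T-t)))` along the real interval `(0, T)`. -/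
noncomputable def flatDeriv (α T : ℝ) (j : ℕ) (t : ℝ) : ℝ :=
  (iteratedDeriv j (flatExp α T) t).re

theorem hasDerivAt_flatDeriv {α T t : ℝ} (ht : t ∈ Ioo 0 T) (j : ℕ) :
    HasDerivAt (flatDeriv α T j) (flatDeriv α T (j + 1) t) t :=
  (hasDerivAt_iteratedDeriv_flatExp ht j).real_of_complex

theorem abs_flatDeriv_le {α T t : ℝ} (hα : 0 ≤ α) (ht : t ∈ Ioo 0 T) (j : ℕ) :
    |flatDeriv α T j t|
      ≤ j.factorial * (2 / min t (T - t)) ^ j * Real.exp (-(2 * α / (3 * min t (T - t)))) :=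
  (Complex.abs_re_le_norm _).trans (norm_iteratedDeriv_flatExp_le hα ht j)

theorem flatDeriv_zero (α T t : ℝ) :
    flatDeriv α T 0 t = Real.exp (-α * (t⁻¹ + (T - t)⁻¹)) := by
  rw [flatDeriv, iteratedDeriv_zero, flatExp]
  have : -(α : ℂ) * ((t : ℂ)⁻¹ + ((T : ℂ) - t)⁻¹) = ((-α * (t⁻¹ + (T - t)⁻¹) : ℝ) : ℂ) := by
    push_cast; rfl
  rw [this, ← Complex.ofReal_exp, Complex.ofReal_re]

theorem continuousOn_flatDeriv (α T : ℝ) (j : ℕ) : ContinuousOn (flatDeriv α T j) (Ioo 0 T) :=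
  fun _ ht => (hasDerivAt_flatDeriv ht j).continuousAt.continuousWithinAt

theorem pow_mul_exp_neg_le (k : ℕ) {x : ℝ} (hx : 0 ≤ x) :
    x ^ k * Real.exp (-x) ≤ k.factorial := by
  have h := Real.pow_div_factorial_le_exp x hx k
  rw [div_le_iff₀ (by positivity)] at h
  rw [Real.exp_neg, ← div_eq_mul_inv, div_le_iff₀ (Real.exp_pos _)]
  linarith

/-- The derivatives are bounded, and vanish at the ends of the interval. -/
theorem exists_abs_flatDeriv_le_mul_min {α T : ℝ} (hα : 0 < α) (j : ℕ) :
    ∃ M : ℝ, 0 ≤ M ∧ ∀ t ∈ Ioo 0 T, |flatDeriv α T j t| ≤ M * min t (T - t) := by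
  -- From `x^(j+1) exp(-x) ≤ (j+1)!` at `x = 2α/(3m)`: one power more than needed to absorb
  -- `m^(-j)`, so that a factor `m` survives.
  refine ⟨j.factorial * (2 ^ j * (3 / (2 * α)) ^ (j + 1) * (j + 1).factorial), by positivity, ?_⟩
  intro t ht
  have hm0 : 0 < min t (T - t) := lt_min ht.1 (sub_pos.mpr ht.2)
  refine (abs_flatDeriv_le hα.le ht j).trans ?_
  set m := min t (T - t)
  have h := pow_mul_exp_neg_le (j + 1) (by positivity : 0 ≤ 2 * α / (3 * m))
  have h1 : (j.factorial : ℝ) * (2 / m) ^ j * Real.exp (-(2 * α / (3 * m)))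
      = j.factorial * (2 ^ j * (3 / (2 * α)) ^ (j + 1)
        * ((2 * α / (3 * m)) ^ (j + 1) * Real.exp (-(2 * α / (3 * m))))) * m := by
    simp only [div_pow, mul_pow, pow_succ]
    field_simp
  rw [h1]
  gcongr

theorem integrableOn_flatDeriv_mul_exp {α T : ℝ} (hα : 0 < α) (hT : 0 < T) (j : ℕ) (b : ℝ) :
    IntegrableOn (fun t => flatDeriv α T j t * Real.exp (-b * t)) (Ioo 0 T) := by
  obtain ⟨M, hM0, hM⟩ := exists_abs_flatDeriv_le_mul_min (T := T) hα j
  have hmeas : AEStronglyMeasurable (fun t => flatDeriv α T j t * Real.exp (-b * t))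
      (volume.restrict (Ioo 0 T)) :=
    ((continuousOn_flatDeriv α T j).mul
      (Continuous.continuousOn (f := fun t => Real.exp (-b * t)) (by fun_prop))).aestronglyMeasurable
      measurableSet_Ioo
  refine Integrable.of_bound hmeas (M * T * Real.exp (|b| * T)) ?_
  filter_upwards [ae_restrict_mem measurableSet_Ioo] with t ht
  rw [norm_mul, Real.norm_eq_abs, Real.norm_of_nonneg (Real.exp_pos _).le]
  have h1 : min t (T - t) ≤ T := (min_le_left _ _).trans ht.2.le
  have h2 : -b * t ≤ |b| * T := by
    have h3 := ht.1.le
    have h4 := ht.2.le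
    exact (mul_le_mul_of_nonneg_right (neg_le_abs b) h3).trans (by gcongr)
  have h3 := hM t ht
  gcongr
  exact h3.trans (by gcongr)

/-- Laplace transform over `(0, T)` of the derivatives: integration by parts without boundary
terms. -/
theorem integral_flatDeriv_mul_exp {α T : ℝ} (hα : 0 < α) (hT : 0 < T) (j : ℕ) (b : ℝ) :
    ∫ t in Ioo 0 T, flatDeriv α T j t * Real.exp (-b * t)
      = b ^ j * ∫ t in Ioo 0 T, flatDeriv α T 0 t * Real.exp (-b * t) := by
  induction j with
  | zero => simp
  | succ j ih =>
    obtain ⟨M, hM0, hM⟩ := exists_abs_flatDeriv_le_mul_min (T := T) hα j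
    have hint := fun i => integrableOn_flatDeriv_mul_exp hα hT i b
    have hderiv : ∀ t ∈ Ioo 0 T, HasDerivAt (fun t => flatDeriv α T j t * Real.exp (-b * t))
        (flatDeriv α T (j + 1) t * Real.exp (-b * t)
          - b * (flatDeriv α T j t * Real.exp (-b * t))) t := by
      intro t ht
      have h1 : HasDerivAt (fun t : ℝ => Real.exp (-b * t)) (Real.exp (-b * t) * (-b * 1)) t :=
        ((hasDerivAt_id t).const_mul (-b)).exp
      refine ((hasDerivAt_flatDeriv ht j).mul h1).congr_deriv ?_
      ring
    have htend : ∀ (c : ℝ) (s : Set ℝ), min c (T - c) = 0 → (∀ᶠ t in nhdsWithin c s, t ∈ Ioo 0 T) →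
        Filter.Tendsto (fun t => flatDeriv α T j t * Real.exp (-b * t)) (nhdsWithin c s)
          (nhds 0) := by
      intro c s hc hs
      have h1 : Filter.Tendsto (fun t => M * min t (T - t) * Real.exp (-b * t)) (nhdsWithin c s)
          (nhds 0) := by
        have : Continuous fun t => M * min t (T - t) * Real.exp (-b * t) := by fun_prop
        have h2 := (this.tendsto c).mono_left (nhdsWithin_le_nhds (s := s))
        simpa [hc] using h2
      refine squeeze_zero_norm' ?_ h1
      filter_upwards [hs] with t ht
      rw [norm_mul, Real.norm_eq_abs, Real.norm_of_nonneg (Real.exp_pos _).le]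
      have := hM t ht
      gcongr
    have hFTC := intervalIntegral.integral_eq_sub_of_hasDerivAt_of_tendsto hT hderiv
      ((intervalIntegrable_iff_integrableOn_Ioo_of_le hT.le).mpr
        ((hint (j + 1)).sub ((hint j).const_mul b)))
      (htend 0 (Ioi 0) (by simp [hT.le]) (Ioo_mem_nhdsGT hT))
      (htend T (Iio T) (by simp [hT.le]) (Ioo_mem_nhdsLT hT))
    rw [intervalIntegral.integral_of_le hT.le, integral_Ioc_eq_integral_Ioo,
      integral_sub (hint (j + 1)) ((hint j).const_mul b), integral_const_mul, ih] at hFTC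
    rw [pow_succ]
    linarith

/-- Lower bound for the Laplace transform of the flat function. -/
theorem le_integral_flatDeriv_zero_mul_exp {α T : ℝ} (hα : 0 < α) (hT : 0 < T) {b : ℝ}
    (hb : 0 ≤ b) :
    T / 2 * Real.exp (-(16 * α / (3 * T)) - 3 * b * T / 4)
      ≤ ∫ t in Ioo 0 T, flatDeriv α T 0 t * Real.exp (-b * t) := by
  have hint := integrableOn_flatDeriv_mul_exp hα hT 0 b
  -- On the middle half, `t (T - t) ≥ 3T²/16`, and `exp (-b t)` loses only `exp (-3bT/4)`. Staying
  -- away from `T` is what leaves decay in `n` at the end.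
  have hsub : Ioo (T / 4) (3 * T / 4) ⊆ Ioo 0 T := fun t ht =>
    ⟨by linarith [ht.1], by linarith [ht.2]⟩
  have h1 : ∫ t in Ioo (T / 4) (3 * T / 4), flatDeriv α T 0 t * Real.exp (-b * t)
      ≤ ∫ t in Ioo 0 T, flatDeriv α T 0 t * Real.exp (-b * t) := by
    refine setIntegral_mono_set hint (Filter.Eventually.of_forall fun t => ?_)
      hsub.eventuallyLE
    simp only [flatDeriv_zero, Pi.zero_apply]
    positivity
  refine le_trans ?_ h1
  have h2 : ∫ t in Ioo (T / 4) (3 * T / 4), Real.exp (-(16 * α / (3 * T)) - 3 * b * T / 4)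
      = T / 2 * Real.exp (-(16 * α / (3 * T)) - 3 * b * T / 4) := by
    rw [setIntegral_const, Real.volume_real_Ioo_of_le (by linarith), smul_eq_mul]
    ring
  rw [← h2]
  refine setIntegral_mono_on (integrableOn_const (by simp)) (hint.mono_set hsub) measurableSet_Ioo
    fun t ht => ?_
  rw [flatDeriv_zero, ← Real.exp_add]
  apply Real.exp_le_exp.mpr
  have ht1 := ht.1
  have ht2 := ht.2
  have ht0 : 0 < t := by linarith
  have htT : 0 < T - t := by linarith
  have h3 : t⁻¹ + (T - t)⁻¹ ≤ 16 / (3 * T) := by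
    rw [inv_eq_one_div, inv_eq_one_div, div_add_div _ _ ht0.ne' htT.ne',
      div_le_div_iff₀ (by positivity) (by positivity)]
    nlinarith [mul_pos (sub_pos.mpr ht1) (sub_pos.mpr ht2)]
  have h4 := mul_le_mul_of_nonneg_left h3 hα.le
  have h5 : α * (16 / (3 * T)) = 16 * α / (3 * T) := by ring
  have h6 : b * t ≤ b * (3 * T / 4) := by gcongr
  linarith

/-! ### Functions with prescribed Laplace transforms on `(0, T)` -/

theorem four_pow_mul_factorial_sq_le (j : ℕ) :
    4 ^ j * j.factorial ^ 2 ≤ (2 * j + 1).factorial := by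
  induction j with
  | zero => simp
  | succ j ih =>
    have h1 : (2 * (j + 1) + 1).factorial
        = (2 * j + 3) * ((2 * j + 2) * (2 * j + 1).factorial) := by
      rw [show 2 * (j + 1) + 1 = (2 * j + 1 + 1) + 1 by ring, Nat.factorial_succ,
        Nat.factorial_succ]
    rw [h1, Nat.factorial_succ]
    calc 4 ^ (j + 1) * ((j + 1) * j.factorial) ^ 2
        = (2 * j + 2) * ((2 * j + 2) * (4 ^ j * j.factorial ^ 2)) := by ring
      _ ≤ (2 * j + 3) * ((2 * j + 2) * (2 * j + 1).factorial) := by gcongr; omega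

/-- The `(2j+1)!` of the moments beats the `j!` of Cauchy's estimate, leaving the terms of an
exponential series. The value `α = 3S²/4` makes the decay `exp (-2α/(3μ))` the exact inverse of its
sum. -/
theorem abs_moment_mul_flatDeriv_le {C S T t : ℝ} (hC : 0 ≤ C) (hS : 0 ≤ S) {m : ℕ → ℝ}
    (hm : ∀ j, |m j| ≤ C * S ^ (2 * j + 1) / ((2 * j + 1).factorial : ℝ)) (ht : t ∈ Ioo 0 T)
    (j : ℕ) :
    |(-1) ^ j * m j * flatDeriv (3 * S ^ 2 / 4) T j t|
      ≤ C * S * Real.exp (-(S ^ 2 / (2 * min t (T - t))))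
        * ((S ^ 2 / (2 * min t (T - t))) ^ j / j.factorial) := by
  have hμ0 : 0 < min t (T - t) := lt_min ht.1 (sub_pos.mpr ht.2)
  have h1 := abs_flatDeriv_le (by positivity : 0 ≤ 3 * S ^ 2 / 4) ht j
  set μ := min t (T - t)
  have h2 : 2 * (3 * S ^ 2 / 4) / (3 * μ) = S ^ 2 / (2 * μ) := by field_simp; ring
  rw [h2] at h1
  have h3 : |m j| ≤ C * S ^ (2 * j + 1) / (4 ^ j * (j.factorial : ℝ) ^ 2) := by
    refine (hm j).trans ?_
    gcongr
    exact_mod_cast four_pow_mul_factorial_sq_le j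
  rw [abs_mul, abs_mul, abs_pow, abs_neg, abs_one, one_pow, one_mul]
  calc |m j| * |flatDeriv (3 * S ^ 2 / 4) T j t|
      ≤ C * S ^ (2 * j + 1) / (4 ^ j * (j.factorial : ℝ) ^ 2)
        * (j.factorial * (2 / μ) ^ j * Real.exp (-(S ^ 2 / (2 * μ)))) := by gcongr
    _ = C * S * Real.exp (-(S ^ 2 / (2 * μ))) * ((S ^ 2 / (2 * μ)) ^ j / j.factorial) := by
        have h4 : (4 : ℝ) ^ j = 2 ^ j * 2 ^ j := by rw [← mul_pow]; norm_num
        rw [h4, pow_succ, pow_mul, div_pow, div_pow, mul_pow]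
        field_simp

/-- The function `∑ (-1)^j m j r_j`, with `r_j` the derivatives of the flat function, is bounded
and its Laplace transform is computed termwise. -/
theorem exists_function_of_moments {C S T : ℝ} (hC : 0 ≤ C) (hS : 0 < S) (hT : 0 < T) {m : ℕ → ℝ}
    (hm : ∀ j, |m j| ≤ C * S ^ (2 * j + 1) / ((2 * j + 1).factorial : ℝ)) :
    ∃ U : ℝ → ℝ, AEStronglyMeasurable U (volume.restrict (Ioo 0 T)) ∧
      (∀ t ∈ Ioo 0 T, |U t| ≤ C * S) ∧
      ∀ b : ℝ, 0 ≤ b → HasSum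
        (fun j => (-1) ^ j * m j * b ^ j
          * ∫ t in Ioo 0 T, flatDeriv (3 * S ^ 2 / 4) T 0 t * Real.exp (-b * t))
        (∫ t in Ioo 0 T, U t * Real.exp (-b * t)) := by
  set r := flatDeriv (3 * S ^ 2 / 4) T with hr
  have hα : 0 < 3 * S ^ 2 / 4 := by positivity
  set x : ℝ → ℝ := fun t => S ^ 2 / (2 * min t (T - t)) with hx
  have hbound : ∀ t ∈ Ioo 0 T, ∀ j, |(-1) ^ j * m j * r j t|
      ≤ C * S * Real.exp (-x t) * (x t ^ j / j.factorial) := fun t ht j =>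
    abs_moment_mul_flatDeriv_le hC hS.le hm ht j
  have hbsum : ∀ t, HasSum (fun j : ℕ => C * S * Real.exp (-x t) * (x t ^ j / j.factorial))
      (C * S) := by
    intro t
    have h1 := (NormedSpace.expSeries_div_hasSum_exp (x t)).mul_left (C * S * Real.exp (-x t))
    rwa [← Real.exp_eq_exp_ℝ, mul_assoc (C * S), ← Real.exp_add, neg_add_cancel, Real.exp_zero,
      mul_one] at h1
  have hsum : ∀ t ∈ Ioo 0 T, HasSum (fun j => (-1) ^ j * m j * r j t)
      (∑' j, (-1) ^ j * m j * r j t) := fun t ht =>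
    (Summable.of_norm_bounded (hbsum t).summable (hbound t ht)).hasSum
  have hterm : ∀ j, AEStronglyMeasurable (fun t => (-1) ^ j * m j * r j t)
      (volume.restrict (Ioo 0 T)) := fun j =>
    ((continuousOn_flatDeriv _ T j).aestronglyMeasurable measurableSet_Ioo).const_mul _
  refine ⟨fun t => ∑' j, (-1) ^ j * m j * r j t, ?_, ?_, ?_⟩
  · refine aestronglyMeasurable_of_tendsto_ae Filter.atTop
      (f := fun k t => ∑ j ∈ Finset.range k, (-1) ^ j * m j * r j t)
      (fun k => Finset.aestronglyMeasurable_fun_sum _ fun j _ => hterm j) ?_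
    filter_upwards [ae_restrict_mem measurableSet_Ioo] with t ht
    exact (hsum t ht).tendsto_sum_nat
  · intro t ht
    exact tsum_of_norm_bounded (f := fun j => (-1) ^ j * m j * r j t) (hbsum t) (hbound t ht)
  · intro b hb
    have heq : ∀ j, (-1) ^ j * m j * b ^ j * ∫ t in Ioo 0 T, r 0 t * Real.exp (-b * t)
        = ∫ t in Ioo 0 T, (-1) ^ j * m j * r j t * Real.exp (-b * t) := by
      intro j
      rw [mul_assoc, ← integral_flatDeriv_mul_exp hα hT j b, ← integral_const_mul]
      simp_rw [mul_assoc]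
      rfl
    simp_rw [heq]
    refine hasSum_integral_of_dominated_convergence
      (fun j t => C * S * Real.exp (-x t) * (x t ^ j / j.factorial))
      (fun j => (hterm j).mul
        (Continuous.aestronglyMeasurable (f := fun t => Real.exp (-b * t)) (by fun_prop)))
      ?_ ?_ ?_ ?_
    · intro j
      filter_upwards [ae_restrict_mem measurableSet_Ioo] with t ht
      rw [norm_mul, Real.norm_of_nonneg (Real.exp_pos _).le]
      refine (mul_le_of_le_one_right (norm_nonneg _) ?_).trans (hbound t ht j)
      rw [Real.exp_le_one_iff]
      nlinarith [ht.1]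
    · exact Filter.Eventually.of_forall fun t => (hbsum t).summable
    · simp_rw [(hbsum _).tsum_eq]
      exact integrable_const _
    · filter_upwards [ae_restrict_mem measurableSet_Ioo] with t ht
      exact (hsum t ht).mul_right _

/-! ### The biorthogonal family -/

/-- A biorthogonal family to `exp (-β l ^ 2 t)` in `L^∞(0, T)`, with explicit dependence on
`T` and `β n`. -/
theorem exists_biorthogonal_exp (g γ : ℝ) (hg : 0 < g) (hγ : 0 < γ) (N : ℕ) (S : ℝ)
    (hS : Real.pi / g < S) :
    ∃ C : ℝ, 0 < C ∧ ∀ β : ℕ+ → ℝ, (∀ n : ℕ+, γ ≤ β (n + 1) - β n) → γ ≤ β 1 →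
      (∀ n : ℕ+, N ≤ (n : ℕ) → g ≤ β (n + 1) - β n) → ∀ T : ℝ, 0 < T → ∀ n : ℕ+,
        ∃ U : ℝ → ℝ, AEStronglyMeasurable U (volume.restrict (Ioo 0 T)) ∧
          (∀ t ∈ Ioo 0 T,
            |U t| ≤ C * (β n / T) * Real.exp (4 * S ^ 2 / T + 3 * β n ^ 2 * T / 4)) ∧
          ∀ l, ∫ t in Ioo 0 T, U t * Real.exp (-(β l ^ 2) * t) = if n = l then 1 else 0 := by
  have hS0 : 0 < S := (by have := Real.pi_pos; positivity : 0 < Real.pi / g).trans hS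
  obtain ⟨C, hC, hmom⟩ := exists_biorthogonal_moments g γ hg hγ N S hS
  refine ⟨2 * (C * S), by positivity, ?_⟩
  intro β hβγ hβ1 hβg T hT n
  obtain ⟨m, hm, hβm⟩ := hmom β hβγ hβ1 hβg n
  obtain ⟨U, hUmeas, hUbound, hU⟩ := exists_function_of_moments hC.le hS0 hT hm
  have hα : 0 < 3 * S ^ 2 / 4 := by positivity
  set c : ℝ → ℝ := fun b =>
    ∫ t in Ioo 0 T, flatDeriv (3 * S ^ 2 / 4) T 0 t * Real.exp (-b * t) with hc
  have hclow : ∀ b, 0 ≤ b → T / 2 * Real.exp (-(4 * S ^ 2 / T + 3 * b * T / 4)) ≤ c b := by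
    intro b hb
    have h1 := le_integral_flatDeriv_zero_mul_exp hα hT hb
    have h2 : -(16 * (3 * S ^ 2 / 4) / (3 * T)) - 3 * b * T / 4
        = -(4 * S ^ 2 / T + 3 * b * T / 4) := by field_simp; ring
    rwa [h2] at h1
  have hcpos : ∀ b, 0 ≤ b → 0 < c b := fun b hb =>
    (by positivity : 0 < T / 2 * Real.exp (-(4 * S ^ 2 / T + 3 * b * T / 4))).trans_le (hclow b hb)
  have hβpos : ∀ l, 0 < β l := by
    intro l
    refine lt_of_lt_of_le ?_ (mul_le_of_succ_gap hβγ hβ1 l)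
    have : (0 : ℝ) < (l : ℕ) := by exact_mod_cast l.pos
    positivity
  -- The moments interpolate odd powers of `β l`, while the Laplace transform of `U` involves the
  -- even powers `(β l ^ 2)^j`; this accounts for the factor `β n`.
  refine ⟨fun t => β n / c (β n ^ 2) * U t, hUmeas.const_mul _, ?_, ?_⟩
  · intro t ht
    have hcn := hcpos (β n ^ 2) (sq_nonneg _)
    have h1 := hclow (β n ^ 2) (sq_nonneg _)
    have h2 : 1 / c (β n ^ 2)
        ≤ 2 / T * Real.exp (4 * S ^ 2 / T + 3 * β n ^ 2 * T / 4) := by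
      rw [div_le_iff₀ hcn]
      calc (1 : ℝ) = 2 / T * Real.exp (4 * S ^ 2 / T + 3 * β n ^ 2 * T / 4)
            * (T / 2 * Real.exp (-(4 * S ^ 2 / T + 3 * β n ^ 2 * T / 4))) := by
            rw [Real.exp_neg]; field_simp
        _ ≤ _ := by gcongr
    have hβn := hβpos n
    rw [abs_mul, abs_of_pos (div_pos hβn hcn)]
    calc β n / c (β n ^ 2) * |U t| = β n * (1 / c (β n ^ 2)) * |U t| := by ring
      _ ≤ β n * (2 / T * Real.exp (4 * S ^ 2 / T + 3 * β n ^ 2 * T / 4)) * (C * S) := by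
          have := hUbound t ht
          gcongr
      _ = _ := by ring
  · intro l
    have h1 := hU (β l ^ 2) (sq_nonneg _)
    have hβl := (hβpos l).ne'
    have h2 : HasSum (fun j => (-1) ^ j * m j * (β l ^ 2) ^ j * c (β l ^ 2))
        ((if n = l then 1 else 0) * (c (β l ^ 2) / β l)) := by
      have h3 := (hβm l).mul_right (c (β l ^ 2) / β l)
      refine h3.congr_fun ?_
      intro j
      rw [pow_succ (β l) (2 * j), pow_mul]
      field_simp
    have h4 := h1.unique h2
    simp_rw [mul_assoc]
    rw [integral_const_mul, h4]
    split_ifs with hnl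
    · subst hnl
      have := (hcpos (β n ^ 2) (sq_nonneg _)).ne'
      field_simp
    · simp

/-- Weighted Cauchy–Schwarz estimate for a series of vectors. -/
theorem summable_smul_and_norm_tsum_sq_le {ι 𝕜 E : Type*} [NormedField 𝕜] [NormedAddCommGroup E]
    [NormedSpace 𝕜 E] [CompleteSpace E] {a : ι → 𝕜} {u : ι → E} {p : ι → ℝ} (hp : ∀ i, 0 < p i)
    (ha : Summable fun i => (p i * ‖a i‖) ^ 2) (hu : Summable fun i => (‖u i‖ / p i) ^ 2) :
    Summable (fun i => a i • u i) ∧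
      ‖∑' i, a i • u i‖ ^ 2 ≤ (∑' i, (p i * ‖a i‖) ^ 2) * ∑' i, (‖u i‖ / p i) ^ 2 := by
  have hpq : Real.HolderConjugate 2 2 := by rw [Real.holderConjugate_iff]; norm_num
  obtain ⟨h1, h2⟩ := Real.summable_and_inner_le_Lp_mul_Lq_tsum_of_nonneg hpq
    (f := fun i => p i * ‖a i‖) (g := fun i => ‖u i‖ / p i)
    (fun i => mul_nonneg (hp i).le (norm_nonneg _))
    (fun i => div_nonneg (norm_nonneg _) (hp i).le)
    (by simpa only [Real.rpow_two] using ha) (by simpa only [Real.rpow_two] using hu)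
  have heq : ∀ i, p i * ‖a i‖ * (‖u i‖ / p i) = ‖a i • u i‖ := by
    intro i
    rw [norm_smul]
    have := (hp i).ne'
    field_simp
  simp_rw [heq, Real.rpow_two, ← Real.sqrt_eq_rpow] at h1 h2
  refine ⟨h1.of_norm, ?_⟩
  have h3 := (norm_tsum_le_tsum_norm h1).trans h2
  calc ‖∑' i, a i • u i‖ ^ 2
      ≤ (√(∑' i, (p i * ‖a i‖) ^ 2) * √(∑' i, (‖u i‖ / p i) ^ 2)) ^ 2 := by gcongr
    _ = _ := by
      rw [mul_pow, Real.sq_sqrt (tsum_nonneg fun i => sq_nonneg _),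
        Real.sq_sqrt (tsum_nonneg fun i => sq_nonneg _)]

theorem mainTheorem5 {𝕜 : Type*} [RCLike 𝕜]
    (γinf γ : ℝ) (hγinf : 0 < γinf) (hγ : 0 < γ) (N : ℕ)
    (S : ℝ) (hS : Real.pi / γinf < S) (ε : ℝ) (hε : 0 < ε) :
    ∃ C : ℝ, 0 < C ∧
      ∀ β : ℕ+ → ℝ,
        (∀ n : ℕ+, γ ≤ β (n + 1) - β n) → γ ≤ β 1 →
        (∀ n : ℕ+, N ≤ (n : ℕ) → γinf ≤ β (n + 1) - β n) →
        ∀ T : ℝ, 0 < T → T ≤ 1 →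
          ∃ u : ℕ+ → Lp 𝕜 2 (volume.restrict (Ioo (0 : ℝ) T)),
            (∀ l n : ℕ+,
              ∫ t in Ioo (0 : ℝ) T, u n t * ((Real.exp (-(β l ^ 2) * t) : ℝ) : 𝕜)
                = if n = l then 1 else 0) ∧
            ∀ a : ℕ+ → 𝕜,
              Memℓp (fun n => (β n ^ 2 * Real.exp (β n ^ 2 * T)) • a n) 2 →
              Summable (fun n => a n • u n) ∧
              Summable (fun n => β n ^ 2 * Real.exp (2 * β n ^ 2 * T) * ‖a n‖ ^ 2) ∧
              ‖∑' n, a n • u n‖ ^ 2 ≤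
                C / T ^ 3 * Real.exp ((16 + ε) * S ^ 2 / T) *
                  ∑' n, β n ^ 2 * Real.exp (2 * β n ^ 2 * T) * ‖a n‖ ^ 2 := by
  obtain ⟨K, hK, hbio⟩ := exists_biorthogonal_exp γinf γ hγinf hγ N S hS
  have hsq : Summable fun n : ℕ+ => 1 / ((n : ℕ) : ℝ) ^ 2 :=
    (Real.summable_one_div_nat_pow.mpr (by norm_num : 1 < 2)).comp_injective PNat.coe_injective
  set Z := ∑' n : ℕ+, 1 / ((n : ℕ) : ℝ) ^ 2 with hZ
  have hZ0 : 0 ≤ Z := tsum_nonneg fun n => by positivity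
  refine ⟨2 * K ^ 2 / γ ^ 2 * (Z + 1), by positivity, ?_⟩
  intro β hβγ hβ1 hβg T hT hT1
  choose U hUmeas hUbound hU using hbio β hβγ hβ1 hβg T hT
  have hβn : ∀ n : ℕ+, γ * (n : ℕ) ≤ β n := mul_le_of_succ_gap hβγ hβ1
  have hn1 : ∀ n : ℕ+, (1 : ℝ) ≤ (n : ℕ) := fun n => by exact_mod_cast n.pos
  have hβpos : ∀ n, 0 < β n := fun n =>
    (mul_pos hγ (by linarith [hn1 n])).trans_le (hβn n)
  set B : ℕ+ → ℝ :=
    fun n => K * (β n / T) * Real.exp (4 * S ^ 2 / T + 3 * β n ^ 2 * T / 4) with hB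
  have hB0 : ∀ n, 0 ≤ B n := fun n => by have := hβpos n; positivity
  have hbound : ∀ n, ∀ᵐ t ∂volume.restrict (Ioo 0 T), ‖((U n t : ℝ) : 𝕜)‖ ≤ B n := by
    intro n
    filter_upwards [ae_restrict_mem measurableSet_Ioo] with t ht
    rw [RCLike.norm_ofReal]
    exact hUbound n t ht
  have hmem : ∀ n, MemLp (fun t => ((U n t : ℝ) : 𝕜)) 2 (volume.restrict (Ioo 0 T)) := fun n =>
    MemLp.of_bound (RCLike.continuous_ofReal.comp_aestronglyMeasurable (hUmeas n)) (B n) (hbound n)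
  have hnorm : ∀ n, ‖(hmem n).toLp _‖ ≤ B n := by
    intro n
    have h1 : ∀ᵐ t ∂volume.restrict (Ioo 0 T), ‖(hmem n).toLp _ t‖ ≤ B n := by
      filter_upwards [(hmem n).coeFn_toLp, hbound n] with t h1 h2
      rwa [h1]
    -- Here `T ≤ 1` enters: on a set of measure at most 1 the L² norm is at most the sup bound.
    refine (Lp.norm_le_of_ae_bound (hB0 n) h1).trans ?_
    refine mul_le_of_le_one_left (hB0 n) ?_
    refine Real.rpow_le_one (NNReal.coe_nonneg _) ?_ (by positivity)
    change (volume.restrict (Ioo 0 T)).real univ ≤ 1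
    rw [measureReal_restrict_apply_univ, Real.volume_real_Ioo_of_le hT.le]
    linarith
  refine ⟨fun n => (hmem n).toLp _, ?_, ?_⟩
  · intro l n
    have h1 : ∫ t in Ioo (0 : ℝ) T,
        (hmem n).toLp _ t * ((Real.exp (-(β l ^ 2) * t) : ℝ) : 𝕜)
        = ∫ t in Ioo (0 : ℝ) T, ((U n t * Real.exp (-(β l ^ 2) * t) : ℝ) : 𝕜) := by
      apply integral_congr_ae
      filter_upwards [(hmem n).coeFn_toLp] with t ht
      rw [ht, RCLike.ofReal_mul]
    rw [h1, integral_ofReal, hU n l]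
    split_ifs <;> simp
  · intro a ha
    set p : ℕ+ → ℝ := fun n => β n * Real.exp (β n ^ 2 * T) with hp
    have hp0 : ∀ n, 0 < p n := fun n => mul_pos (hβpos n) (Real.exp_pos _)
    have hpa : ∀ n, β n ^ 2 * Real.exp (2 * β n ^ 2 * T) * ‖a n‖ ^ 2 = (p n * ‖a n‖) ^ 2 := by
      intro n
      have : Real.exp (2 * β n ^ 2 * T) = Real.exp (β n ^ 2 * T) ^ 2 := by
        rw [← Real.exp_nat_mul]
        push_cast
        ring_nf
      rw [this, hp]
      ring
    -- The hypothesis on `a` carries one factor `β n` more than `p n`; it is dropped using `β n ≥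
    -- γ`.
    have hasum : Summable fun n => (p n * ‖a n‖) ^ 2 := by
      rw [memℓp_gen_iff (by norm_num)] at ha
      simp only [ENNReal.toReal_ofNat, Real.rpow_two] at ha
      refine (ha.mul_left (1 / γ ^ 2)).of_nonneg_of_le (fun n => sq_nonneg _) fun n => ?_
      have h1 : γ ≤ β n := by
        have := hβn n
        nlinarith [hn1 n]
      have h2 : ‖(β n ^ 2 * Real.exp (β n ^ 2 * T)) • a n‖ = β n * (p n * ‖a n‖) := by
        rw [norm_smul, Real.norm_of_nonneg (by positivity), hp]
        ring
      rw [h2, mul_pow (β n), ← mul_assoc]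
      refine le_mul_of_one_le_left (sq_nonneg _) ?_
      rw [one_div, ← div_eq_inv_mul, one_le_div (by positivity)]
      gcongr
    have hterm : ∀ n, (‖(hmem n).toLp _‖ / p n) ^ 2
        ≤ 2 * K ^ 2 / γ ^ 2 / T ^ 3 * Real.exp (8 * S ^ 2 / T) * (1 / ((n : ℕ) : ℝ) ^ 2) := by
      intro n
      have hβ0 := hβpos n
      have hn0 : (0 : ℝ) < (n : ℕ) := by linarith [hn1 n]
      have hb0 : 0 < β n ^ 2 * T / 2 := by positivity
      have h1 : (B n / p n) ^ 2
          = K ^ 2 / T ^ 2 * Real.exp (8 * S ^ 2 / T) * Real.exp (-(β n ^ 2 * T / 2)) := by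
        have h2 : B n / p n = K / T * Real.exp (4 * S ^ 2 / T - β n ^ 2 * T / 4) := by
          have h3 : 4 * S ^ 2 / T + 3 * β n ^ 2 * T / 4
              = (4 * S ^ 2 / T - β n ^ 2 * T / 4) + β n ^ 2 * T := by ring
          rw [hB, hp]
          simp only
          rw [h3, Real.exp_add]
          field_simp
        rw [h2, mul_pow, div_pow, ← Real.exp_nat_mul, mul_assoc, ← Real.exp_add]
        push_cast
        ring_nf
      -- The inequality `exp (-x) ≤ 1/x` with `β n ≥ γ n` trades the remaining decay for a summable
      -- `1/n²` and one more `1/T`, which brings `T⁻²` to `T⁻³`.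
      have h2 : Real.exp (-(β n ^ 2 * T / 2)) ≤ 2 / (γ ^ 2 * (n : ℕ) ^ 2 * T) := by
        have h3 := pow_mul_exp_neg_le 1 hb0.le
        rw [pow_one, Nat.factorial_one, Nat.cast_one, ← le_div_iff₀' hb0] at h3
        refine h3.trans ?_
        rw [one_div_div, ← mul_pow]
        have := hβn n
        gcongr
      have h3 : (‖(hmem n).toLp _‖ / p n) ^ 2 ≤ (B n / p n) ^ 2 := by
        have := hnorm n
        have := hp0 n
        gcongr
      refine h3.trans ?_
      rw [h1]
      calc K ^ 2 / T ^ 2 * Real.exp (8 * S ^ 2 / T) * Real.exp (-(β n ^ 2 * T / 2))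
          ≤ K ^ 2 / T ^ 2 * Real.exp (8 * S ^ 2 / T) * (2 / (γ ^ 2 * (n : ℕ) ^ 2 * T)) := by
            gcongr
        _ = _ := by field_simp
    have husum : Summable fun n => (‖(hmem n).toLp _‖ / p n) ^ 2 :=
      (hsq.mul_left _).of_nonneg_of_le (fun n => sq_nonneg _) hterm
    obtain ⟨hs, hle⟩ := summable_smul_and_norm_tsum_sq_le hp0 hasum husum
    refine ⟨hs, ?_, ?_⟩
    · simpa only [hpa] using hasum
    · simp_rw [hpa]
      refine hle.trans ?_
      rw [mul_comm]
      refine mul_le_mul_of_nonneg_right ?_ (tsum_nonneg fun n => sq_nonneg _)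
      have h1 := husum.tsum_le_tsum hterm (hsq.mul_left _)
      rw [tsum_mul_left] at h1
      refine h1.trans ?_
      have h2 : Real.exp (8 * S ^ 2 / T) ≤ Real.exp ((16 + ε) * S ^ 2 / T) := by
        gcongr
        linarith
      calc 2 * K ^ 2 / γ ^ 2 / T ^ 3 * Real.exp (8 * S ^ 2 / T) * Z
          ≤ 2 * K ^ 2 / γ ^ 2 / T ^ 3 * Real.exp ((16 + ε) * S ^ 2 / T) * (Z + 1) := by
            gcongr
            linarith
        _ = _ := by ring
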